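/- Let $\mathcal L\subset\mathbb C$ be a lattice of rank two, with Weierstrass functions $\wp$ and $\zeta$. Let $\omega$ be a half-period, that is, $2\omega\in\mathcal L$ and $\omega\notin\mathcal L$, put $\eta=\zeta(\omega)$, and let $z_0\in\mathbb C$ be such that the line $\{\omega x+z_0:x\in\mathbb R\}$ does not meet $\mathcal L$. Let $\Sigma\subset\mathbb C$ be the spectrum of the complex Lamé operator with $m=1$, $$L=-\frac{d^2}{dx^2}+2\omega^2\wp(\omega x+z_0),$$ acting in $L^2(\mathbb R)$ with domain $H^2(\mathbb R)$. Then, outside a bounded set, $\Sigma$ consists of a single regular analytic arc extending to infinity: there are $\delta>0$ and an injective real-analytic map $\lambda:(0,\delta)\to\mathbb C$ with nowhere vanishing derivative, whose image $\Gamma=\lambda((0,\delta))$ is contained in $\Sigma$, such that $\Sigma\setminus\Gamma$ is bounded. The map can be chosen so that along this arc $$\lambda(s)=\frac1{s^2}-2\eta\omega+O(s^2),\qquad s\to0^+,$$ and $\Gamma$ is asymptotic to the positive real half-line shifted by $-2\eta\omega$, $H=\{t-2\eta\omega:t\ge0\}$: the distance from $z\in\Gamma$ to $H$ tends to $0$ as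 $|z|\to\infty$, and the distance from $z\in H$ to $\Gamma$ tends to $0$ as $|z|\to\infty$. -/

import Mathlib

open Set Filter Topology MeasureTheory Asymptotics Bornology

/-- The Weierstrass zeta function of the lattice of `L`,
`ζ(z) = 1/z + ∑_{l ≠ 0} (1/(z - l) + 1/l + z/l²)`.
The summand at `l = 0` is `1/z`, since `1/0 = 0`. -/
noncomputable def weierstrassZeta (L : PeriodPair) (z : ℂ) : ℂ :=
  ∑' l : L.lattice, (1 / (z - l) + 1 / (l : ℂ) + z / (l : ℂ) ^ 2)

/-- The potential `m(m+1) ω² ℘(ω x + z₀)` of the complex Lamé operator. -/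
noncomputable def lamePotential (L : PeriodPair) (m : ℕ) (ω z₀ : ℂ) (x : ℝ) : ℂ :=
  (m : ℂ) * ((m : ℂ) + 1) * ω ^ 2 * L.weierstrassP (ω * (x : ℂ) + z₀)

/-- The complex Hilbert space `L²(ℝ)`. -/
abbrev L2Line : Type := Lp ℂ 2 (volume : Measure ℝ)

/-- `f ∈ L²(ℝ)` belongs to the Sobolev space `H²(ℝ)` and has second derivative `h ∈ L²(ℝ)`:
`f` has a differentiable representative `u` whose derivative `v` is locally absolutely
continuous with a.e. derivative `h`. -/
def HasSecondDerivL2 (f h : L2Line) : Prop :=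
  ∃ u v : ℝ → ℂ, (f : ℝ → ℂ) =ᵐ[volume] u ∧ (∀ x, HasDerivAt u (v x) x) ∧
    ∀ x : ℝ, v x = v 0 + ∫ t in (0 : ℝ)..x, h t

/-- The graph of the Schrödinger operator `-d²/dx² + q` in `L²(ℝ)` with domain `H²(ℝ)`
(for a bounded potential `q`): `f` lies in the domain and is mapped to `g`. -/
def SchrodingerGraph (q : ℝ → ℂ) (f g : L2Line) : Prop :=
  ∃ h : L2Line, HasSecondDerivL2 f h ∧
    (g : ℝ → ℂ) =ᵐ[volume] fun x => -h x + q x * f x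

/-- The resolvent set: those `lam` for which `-d²/dx² + q - lam` maps its domain bijectively onto
`L²(ℝ)`, with a bounded inverse `R`. -/
def schrodingerResolventSet (q : ℝ → ℂ) : Set ℂ :=
  {lam | ∃ R : L2Line →L[ℂ] L2Line,
    ∀ f g : L2Line, R g = f ↔ SchrodingerGraph q f (g + lam • f)}

/-- The spectrum of `-d²/dx² + q` as an unbounded operator in `L²(ℝ)`. -/
def schrodingerSpectrum (q : ℝ → ℂ) : Set ℂ :=
  (schrodingerResolventSet q)ᶜ

/-- The spectrum of the complex Lamé operator `-d²/dx² + m(m+1) ω² ℘(ω x + z₀)`. -/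
noncomputable def lameSpectrum (L : PeriodPair) (m : ℕ) (ω z₀ : ℂ) : Set ℂ :=
  schrodingerSpectrum (lamePotential L m ω z₀)

/-- Two subsets of the plane are asymptotic to each other: the distance of a point of either one
to the other set tends to `0` as the point tends to infinity. -/
def AsymptoticAtInfinity (S T : Set ℂ) : Prop :=
  Tendsto (fun z => Metric.infDist z T) (cobounded ℂ ⊓ 𝓟 S) (𝓝 0) ∧
    Tendsto (fun z => Metric.infDist z S) (cobounded ℂ ⊓ 𝓟 T) (𝓝 0)

/-- The half-line `[0, ∞) + c`. -/
def shiftedHalfLine (c : ℂ) : Set ℂ :=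
  {z | ∃ t : ℝ, 0 ≤ t ∧ z = (t : ℂ) + c}

/-! Put `q = 2ω²℘(ωx + z₀)`, a continuous potential of period 2. For a spectral parameter `λ` let `E
= -λ/ω²` and `P² = 4E³ - g₂E - g₃`. The function `φ = ω(℘' - P)/(2(℘ - E))` on the line satisfies
the Riccati equation `φ' + φ² = q - λ` (`hasDerivAt_lameLogDeriv`), so `exp ∫ φ` is a Floquet
solution with multiplier `exp M`, where `M` is the integral of `φ` over a period. For `|λ|` large,
`|℘| < |E|` on the whole line, so `φ` has no poles.

The operator then factors as `q - λ - d²/dx² = -(d/dx + φ)(d/dx - φ)`. If `Re M ≠ 0`, both first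
order factors are boundedly invertible in `L²` and `λ` lies in the resolvent set
(`mem_schrodingerResolventSet_of_riccati`). If `Re M = 0`, the Floquet solution is bounded and slow
cutoffs of it are approximate eigenfunctions (`mem_schrodingerSpectrum_of_riccati`). So for large
`λ` the spectrum is given by `Re M = 0`, equivalently `-M²/4 ≥ 0`.

Squaring removes the choice of `P`: `-M²/4 = λ Q(1/λ)` with `Q` analytic at 0, `Q(0) = 1` and `Q'(0)
= 2ηω`, the last because `-ζ` is a primitive of `℘` (`lameQuasimomentumSq_asymptotics`). In the
variable `w = 1/λ` the condition says that `w/Q(w)` is a positive real `s²`; this map is locally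
invertible at 0, and its inverse parametrizes the arc (`exists_analytic_arc`). The asymptotics are
`λ + 2ηω + O(1/λ) = 1/s²`. -/

lemma HasDerivAt.comp_ofReal_line {F : ℂ → ℂ} {F' ω z₀ : ℂ} {x : ℝ}
    (h : HasDerivAt F F' (ω * x + z₀)) :
    HasDerivAt (fun x : ℝ ↦ F (ω * x + z₀)) (ω * F') x := by
  have hlin : HasDerivAt (fun x : ℝ ↦ ω * (x : ℂ) + z₀) ω x := by
    simpa using ((Complex.ofRealCLM.hasDerivAt (x := x)).const_mul ω).add_const z₀
  exact (HasDerivAt.comp (h₂ := F) x h hlin).congr_deriv (mul_comm _ _)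

/-! ### The Weierstrass zeta function and the second order equation for `℘`. -/

namespace PeriodPair

variable (L : PeriodPair)

lemma weierstrassZeta_summand_bound (r : ℝ) (hr : 0 < r) (s : ℂ) (hs : ‖s‖ < r) (l : ℂ)
    (h : 2 * r ≤ ‖l‖) :
    ‖1 / (s - l) + 1 / l + s / l ^ 2‖ ≤ 2 * r ^ 2 * ‖l‖ ^ (-3 : ℝ) := by
  have hsl : s ≠ l := by rintro rfl; linarith
  have hl : 0 < ‖l‖ := by linarith
  have hl0 : l ≠ 0 := norm_pos_iff.mp hl
  have h1 : 1 / (s - l) + 1 / l + s / l ^ 2 = s ^ 2 / (l ^ 2 * (s - l)) := by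
    have : s - l ≠ 0 := sub_ne_zero.mpr hsl
    field_simp
    ring
  have h2 : ‖l‖ / 2 ≤ ‖s - l‖ := by
    rw [norm_sub_rev]
    exact .trans (by linarith) (norm_sub_norm_le l s)
  calc
    _ = ‖s‖ ^ 2 / (‖l‖ ^ 2 * ‖s - l‖) := by rw [h1]; simp
    _ ≤ r ^ 2 / (‖l‖ ^ 2 * (‖l‖ / 2)) := by gcongr
    _ = 2 * r ^ 2 / ‖l‖ ^ 3 := by field_simp
    _ = _ := by norm_cast

lemma hasSumLocallyUniformly_weierstrassZeta :
    HasSumLocallyUniformly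
      (fun (l : L.lattice) (z : ℂ) ↦ 1 / (z - l) + 1 / (l : ℂ) + z / (l : ℂ) ^ 2)
      (weierstrassZeta L) := by
  refine L.hasSumLocallyUniformly_aux (u := (2 * · ^ 2 * ‖·‖ ^ (-3 : ℝ))) _
    (fun _ _ ↦ (ZLattice.summable_norm_rpow _ _ (by simp; norm_num)).mul_left _) fun r hr ↦
    Filter.eventually_atTop.mpr ⟨2 * r, ?_⟩
  rintro _ h s hs l rfl
  exact weierstrassZeta_summand_bound r hr s hs l h

lemma isOpen_compl_lattice : IsOpen (L.latticeᶜ : Set ℂ) := L.isClosed_lattice.isOpen_compl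

lemma hasDerivAt_weierstrassZeta_summand (l : L.lattice) {z : ℂ} (hz : z ∉ L.lattice) :
    HasDerivAt (fun z : ℂ ↦ 1 / (z - l) + 1 / (l : ℂ) + z / (l : ℂ) ^ 2)
      (-(1 / (z - l) ^ 2 - 1 / (l : ℂ) ^ 2)) z := by
  have hzl : z - l ≠ 0 := fun e ↦ hz (by rw [sub_eq_zero.mp e]; exact l.2)
  have h := (((hasDerivAt_id z).sub_const (l : ℂ)).inv hzl).add_const (1 / (l : ℂ))
  have h2 := h.add ((hasDerivAt_id z).div_const ((l : ℂ) ^ 2))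
  refine (h2.congr_deriv ?_).congr_of_eventuallyEq (.of_forall fun w ↦ ?_)
  · simp only [id]; ring
  · simp

lemma hasDerivAt_weierstrassZeta {z : ℂ} (hz : z ∉ L.lattice) :
    HasDerivAt (weierstrassZeta L) (-L.weierstrassP z) z := by
  have hd : DifferentiableOn ℂ (weierstrassZeta L) L.latticeᶜ :=
    L.hasSumLocallyUniformly_weierstrassZeta.hasSumLocallyUniformlyOn.differentiableOn
      (.of_forall fun s ↦ .fun_sum fun i _ w hw ↦
        (L.hasDerivAt_weierstrassZeta_summand i hw).differentiableAt.differentiableWithinAt)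
      L.isOpen_compl_lattice
  have he : Set.EqOn (deriv (weierstrassZeta L)) (fun w ↦ -L.weierstrassP w) L.latticeᶜ := by
    refine (L.hasSumLocallyUniformly_weierstrassZeta.tendstoLocallyUniformlyOn.deriv
      (.of_forall fun s ↦ .fun_sum fun i _ w hw ↦
        (L.hasDerivAt_weierstrassZeta_summand i hw).differentiableAt.differentiableWithinAt)
      L.isOpen_compl_lattice).unique ?_
    have hneg : TendstoLocallyUniformlyOn
        (fun (s : Finset L.lattice) (w : ℂ) ↦ -∑ l ∈ s, (1 / (w - l) ^ 2 - 1 / (l : ℂ) ^ 2))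
        (fun w ↦ -L.weierstrassP w) atTop L.latticeᶜ :=
      L.hasSumLocallyUniformly_weierstrassP.tendstoLocallyUniformlyOn.neg
    refine hneg.congr fun s w hw ↦ ?_
    simp only [Function.comp_apply]
    rw [deriv_fun_sum
      (fun i _ ↦ (L.hasDerivAt_weierstrassZeta_summand i hw).differentiableAt),
      ← Finset.sum_neg_distrib]
    exact Finset.sum_congr rfl fun i _ ↦
      (L.hasDerivAt_weierstrassZeta_summand i hw).deriv.symm
  rw [← show deriv (weierstrassZeta L) z = -L.weierstrassP z from he hz]
  exact (hd.differentiableAt (L.isOpen_compl_lattice.mem_nhds hz)).hasDerivAt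

lemma weierstrassZeta_neg (z : ℂ) : weierstrassZeta L (-z) = -weierstrassZeta L z := by
  simp only [weierstrassZeta]
  rw [← (Equiv.neg L.lattice).tsum_eq, ← tsum_neg]
  congr with l
  simp only [Equiv.neg_apply, NegMemClass.coe_neg]
  rw [show -z - -(l : ℂ) = -(z - l) by ring]
  simp only [one_div, inv_neg, neg_sq]
  ring

lemma isPreconnected_compl_lattice : IsPreconnected (L.latticeᶜ : Set ℂ) := by
  have : Countable L.lattice := Countable.of_equiv _ L.latticeEquivProd.symm.toEquiv
  refine (Set.Countable.isPathConnected_compl_of_one_lt_rank (E := ℂ) ?_ ?_).isConnected.2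
  · simp
  · exact Set.to_countable (L.lattice : Set ℂ)

/-- The increment of `ζ` over a period has zero derivative on the connected complement of the
lattice. Its constant value is read off at `-ω`, where oddness gives `ζ(ω) - ζ(-ω) = 2ζ(ω)`. -/
lemma weierstrassZeta_add_two_mul {ω z : ℂ} (hω : ω ∉ L.lattice) (h2ω : 2 * ω ∈ L.lattice)
    (hz : z ∉ L.lattice) :
    weierstrassZeta L (z + 2 * ω) = weierstrassZeta L z + 2 * weierstrassZeta L ω := by
  have hadd {w : ℂ} (hw : w ∉ L.lattice) : w + 2 * ω ∉ L.lattice := fun h ↦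
    hw (by simpa using sub_mem h h2ω)
  have hder {w : ℂ} (hw : w ∉ L.lattice) :
      HasDerivAt (fun w ↦ weierstrassZeta L (w + 2 * ω) - weierstrassZeta L w) 0 w := by
    have h1 := (L.hasDerivAt_weierstrassZeta (hadd hw)).comp_add_const w (2 * ω)
    refine (h1.sub (L.hasDerivAt_weierstrassZeta hw)).congr_deriv ?_
    have := L.weierstrassP_add_coe w ⟨2 * ω, h2ω⟩
    simp only at this
    rw [this]; ring
  have hneg : -ω ∉ L.lattice := fun h ↦ hω (by simpa using neg_mem h)
  have hc := L.isOpen_compl_lattice.is_const_of_deriv_eq_zero L.isPreconnected_compl_lattice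
    (f := fun w ↦ weierstrassZeta L (w + 2 * ω) - weierstrassZeta L w)
    (fun w hw ↦ (hder hw).differentiableAt.differentiableWithinAt)
    (fun w hw ↦ (hder hw).deriv) hz (y := -ω) hneg
  simp only [weierstrassZeta_neg] at hc
  rw [show -ω + 2 * ω = ω by ring] at hc
  linear_combination hc

lemma hasDerivAt_weierstrassP {z : ℂ} (hz : z ∉ L.lattice) :
    HasDerivAt L.weierstrassP (L.derivWeierstrassP z) z := by
  rw [← L.deriv_weierstrassP]
  exact (L.analyticOnNhd_weierstrassP z hz).differentiableAt.hasDerivAt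

/-- Differentiating the cubic equation for `℘'²` gives the claim multiplied by `℘'`. On the
connected complement of the lattice one of the two analytic factors vanishes identically. It cannot
be `℘'`, since `℘` would then be constant, against its pole at 0. -/
lemma hasDerivAt_derivWeierstrassP {z : ℂ} (hz : z ∉ L.lattice) :
    HasDerivAt L.derivWeierstrassP (6 * L.weierstrassP z ^ 2 - L.g₂ / 2) z := by
  have hP {w : ℂ} (hw : w ∉ L.lattice) :=
    (L.analyticOnNhd_derivWeierstrassP w hw).differentiableAt.hasDerivAt
  have hprod : ∀ w ∈ (L.latticeᶜ : Set ℂ), L.derivWeierstrassP w *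
      (deriv L.derivWeierstrassP w - (6 * L.weierstrassP w ^ 2 - L.g₂ / 2)) = 0 := by
    intro w hw
    have h1 := (hP hw).pow 2
    have h2 := ((((L.hasDerivAt_weierstrassP hw).pow 3).const_mul 4).sub
      ((L.hasDerivAt_weierstrassP hw).const_mul L.g₂)).sub_const L.g₃
    have h3 := h1.unique (h2.congr_of_eventuallyEq <| by
      filter_upwards [L.isOpen_compl_lattice.mem_nhds hw] with y hy
      simpa using L.derivWeierstrassP_sq y hy)
    simp at h3
    linear_combination h3 / 2
  have hA : AnalyticOnNhd ℂ L.derivWeierstrassP (L.latticeᶜ : Set ℂ) :=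
    L.analyticOnNhd_derivWeierstrassP
  have hB : AnalyticOnNhd ℂ
      (fun w ↦ deriv L.derivWeierstrassP w - (6 * L.weierstrassP w ^ 2 - L.g₂ / 2))
      (L.latticeᶜ : Set ℂ) :=
    hA.deriv.sub ((analyticOnNhd_const.mul (L.analyticOnNhd_weierstrassP.pow 2)).sub
      analyticOnNhd_const)
  rcases hA.eq_zero_or_eq_zero_of_mul_eq_zero hB hprod L.isPreconnected_compl_lattice with h | h
  · exfalso
    have hconst : ∀ w ∈ (L.latticeᶜ : Set ℂ), L.weierstrassP w = L.weierstrassP z := by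
      intro w hw
      exact L.isOpen_compl_lattice.is_const_of_deriv_eq_zero L.isPreconnected_compl_lattice
        (fun y hy ↦ (L.hasDerivAt_weierstrassP hy).differentiableAt.differentiableWithinAt)
        (fun y hy ↦ by simpa using h y hy) hw hz
    have hord := L.order_weierstrassP 0 (zero_mem _)
    have hev : ∀ᶠ w in 𝓝[≠] (0 : ℂ), L.weierstrassP w = L.weierstrassP z := by
      have : (L.lattice \ {0} : Set ℂ)ᶜ ∈ 𝓝 (0 : ℂ) :=
        L.compl_lattice_sdiff_singleton_mem_nhds 0
      filter_upwards [nhdsWithin_le_nhds this, self_mem_nhdsWithin] with w hw hw0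
      refine hconst w fun hwL ↦ hw ⟨hwL, hw0⟩
    rw [meromorphicOrderAt_congr hev, meromorphicOrderAt_const] at hord
    split_ifs at hord
    · exact absurd hord (by decide)
    · exact absurd hord (by decide)
  · rw [← sub_eq_zero.mp (h z hz)]
    exact hP hz

/-- Integral of `℘` along a translate of a period segment. -/
lemma integral_weierstrassP_segment {ω z₀ : ℂ} (hω : ω ∉ L.lattice) (h2ω : 2 * ω ∈ L.lattice)
    (hz₀ : ∀ x : ℝ, ω * (x : ℂ) + z₀ ∉ L.lattice) :
    ω * ∫ x in (0 : ℝ)..2, L.weierstrassP (ω * x + z₀) = -2 * weierstrassZeta L ω := by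
  have hcont : Continuous fun x : ℝ ↦ L.weierstrassP (ω * x + z₀) :=
    continuous_iff_continuousAt.mpr fun x ↦
      (L.hasDerivAt_weierstrassP (hz₀ x)).comp_ofReal_line.continuousAt
  have hder (x : ℝ) : HasDerivAt (fun x : ℝ ↦ -weierstrassZeta L (ω * x + z₀))
      (ω * L.weierstrassP (ω * x + z₀)) x :=
    (L.hasDerivAt_weierstrassZeta (hz₀ x)).comp_ofReal_line.neg.congr_deriv (by ring)
  rw [← intervalIntegral.integral_const_mul,
    intervalIntegral.integral_eq_sub_of_hasDerivAt (fun x _ ↦ hder x)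
      ((continuous_const.mul hcont).intervalIntegrable _ _)]
  have := L.weierstrassZeta_add_two_mul hω h2ω (z := z₀) (by simpa using hz₀ 0)
  simp only [Complex.ofReal_ofNat, Complex.ofReal_zero, mul_zero, zero_add]
  rw [show ω * 2 + z₀ = z₀ + 2 * ω by ring, this]
  ring

end PeriodPair

/-! ### Convolution with an integrable kernel on `L²`. -/

section SchurTest

lemma sq_lintegral_le {α : Type*} [MeasurableSpace α] (μ : Measure α) {g : α → ENNReal}
    (hg : AEMeasurable g μ) :
    (∫⁻ a, g a ∂μ) ^ 2 ≤ μ univ * ∫⁻ a, g a ^ 2 ∂μ := by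
  have h := ENNReal.lintegral_mul_le_Lp_mul_Lq μ Real.HolderConjugate.two_two
    (aemeasurable_const (b := (1 : ENNReal))) hg
  simp only [Pi.mul_apply, one_mul, lintegral_const, ENNReal.rpow_ofNat, one_pow] at h
  calc (∫⁻ a, g a ∂μ) ^ 2
      ≤ (μ univ ^ (1 / 2 : ℝ) * (∫⁻ a, g a ^ 2 ∂μ) ^ (1 / 2 : ℝ)) ^ 2 := by gcongr
    _ = μ univ * ∫⁻ a, g a ^ 2 ∂μ := by
      rw [mul_pow, ← ENNReal.rpow_natCast, ← ENNReal.rpow_natCast, ← ENNReal.rpow_mul,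
        ← ENNReal.rpow_mul]
      norm_num

/-- Cauchy–Schwarz for the measure `K(x - y) dy`, whose mass does not depend on `x`, followed by
Tonelli. -/
lemma lintegral_sq_convolution_le {K g : ℝ → ENNReal} (hK : Measurable K)
    (hg : AEMeasurable g volume) :
    ∫⁻ x, (∫⁻ y, K (x - y) * g y) ^ 2 ≤ (∫⁻ t, K t) ^ 2 * ∫⁻ y, g y ^ 2 := by
  have hKx (x : ℝ) : Measurable fun y ↦ K (x - y) := hK.comp (by fun_prop)
  have hpt (x : ℝ) : (∫⁻ y, K (x - y) * g y) ^ 2 ≤ (∫⁻ t, K t) * ∫⁻ y, K (x - y) * g y ^ 2 := by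
    have h := sq_lintegral_le (volume.withDensity fun y ↦ K (x - y))
      (hg.mono_ac (withDensity_absolutelyContinuous _ _))
    rw [lintegral_withDensity_eq_lintegral_mul₀ (hKx x).aemeasurable hg,
      lintegral_withDensity_eq_lintegral_mul₀ (hKx x).aemeasurable (hg.pow_const 2),
      withDensity_apply _ MeasurableSet.univ, Measure.restrict_univ,
      lintegral_sub_left_eq_self] at h
    exact h
  calc ∫⁻ x, (∫⁻ y, K (x - y) * g y) ^ 2
      ≤ ∫⁻ x, (∫⁻ t, K t) * ∫⁻ y, K (x - y) * g y ^ 2 := lintegral_mono hpt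
    _ ≤ (∫⁻ t, K t) * ∫⁻ x, ∫⁻ y, K (x - y) * g y ^ 2 := by
      rw [lintegral_const_mul'']
      refine AEMeasurable.lintegral_prod_right' (f := fun p : ℝ × ℝ ↦ K (p.1 - p.2) * g p.2 ^ 2) ?_
      exact (hK.comp measurable_sub).aemeasurable.mul (hg.comp_snd.pow_const 2)
    _ = (∫⁻ t, K t) ^ 2 * ∫⁻ y, g y ^ 2 := by
      rw [lintegral_lintegral_swap
        ((hK.comp measurable_sub).aemeasurable.mul (hg.comp_snd.pow_const 2)), sq, mul_assoc]
      congr 1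
      rw [← lintegral_const_mul'' _ (hg.pow_const 2)]
      refine lintegral_congr fun y ↦ ?_
      rw [lintegral_mul_const _ (show Measurable fun x ↦ K (x - y) from hK.comp (by fun_prop)),
        lintegral_sub_right_eq_self K y]

lemma eLpNorm_two_le_of_enorm_le_convolution {E F : Type*} [NormedAddCommGroup E]
    [NormedAddCommGroup F] {K : ℝ → ENNReal} {f : ℝ → E} {g : ℝ → F} (hK : Measurable K)
    (hg : AEStronglyMeasurable g volume) (h : ∀ x, ‖f x‖ₑ ≤ ∫⁻ y, K (x - y) * ‖g y‖ₑ) :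
    eLpNorm f 2 volume ≤ (∫⁻ t, K t) * eLpNorm g 2 volume := by
  have hint : ∫⁻ x, ‖f x‖ₑ ^ 2 ≤ (∫⁻ t, K t) ^ 2 * ∫⁻ y, ‖g y‖ₑ ^ 2 :=
    (lintegral_mono fun x ↦ pow_le_pow_left' (h x) 2).trans
      (lintegral_sq_convolution_le hK hg.enorm)
  simp only [eLpNorm_eq_lintegral_rpow_enorm_toReal two_ne_zero ENNReal.ofNat_ne_top,
    ENNReal.toReal_ofNat, ENNReal.rpow_ofNat]
  calc (∫⁻ x, ‖f x‖ₑ ^ 2) ^ (1 / 2 : ℝ)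
      ≤ ((∫⁻ t, K t) ^ 2 * ∫⁻ y, ‖g y‖ₑ ^ 2) ^ (1 / 2 : ℝ) := by gcongr
    _ = _ := by
      rw [ENNReal.mul_rpow_of_nonneg _ _ (by norm_num), ← ENNReal.rpow_natCast,
        ← ENNReal.rpow_mul]
      norm_num

end SchurTest

/-! ### Product rule for absolutely continuous primitives. -/

section ProductRule

lemma absolutelyContinuousOnInterval_const {E : Type*} [NormedAddCommGroup E] (c : E) (a b : ℝ) :
    AbsolutelyContinuousOnInterval (fun _ : ℝ ↦ c) a b :=
  (LipschitzWith.const c).lipschitzOnWith.absolutelyContinuousOnInterval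

lemma MeasureTheory.LocallyIntegrable.absolutelyContinuousOnInterval_integral {f : ℝ → ℂ}
    (h : LocallyIntegrable f volume) (a b : ℝ) :
    AbsolutelyContinuousOnInterval (fun x ↦ ∫ v in a..x, f v) a b := by
  have hi (x y : ℝ) : IntervalIntegrable f volume x y :=
    (h.integrableOn_isCompact isCompact_uIcc).intervalIntegrable
  have hre : IntervalIntegrable (fun x ↦ (f x).re) volume a b := ⟨(hi a b).1.re, (hi a b).2.re⟩
  have him : IntervalIntegrable (fun x ↦ (f x).im) volume a b := ⟨(hi a b).1.im, (hi a b).2.im⟩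
  have h1 := (hre.absolutelyContinuousOnInterval_intervalIntegral (c := a) (by simp)).fun_smul
    (absolutelyContinuousOnInterval_const (1 : ℂ) a b)
  have h2 := (him.absolutelyContinuousOnInterval_intervalIntegral (c := a) (by simp)).fun_smul
    (absolutelyContinuousOnInterval_const Complex.I a b)
  convert! h1.add h2 using 1
  funext x
  have e1 := Complex.reCLM.intervalIntegral_comp_comm (hi a x)
  have e2 := Complex.imCLM.intervalIntegral_comp_comm (hi a x)
  simp only [Complex.reCLM_apply, Complex.imCLM_apply] at e1 e2
  simp only [Pi.add_apply, e1, e2, Complex.real_smul, mul_one]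
  exact (Complex.re_add_im _).symm

/-- Product rule for a continuously differentiable function and a primitive of a locally
integrable function. -/
lemma mul_primitive_eq {u u' g : ℝ → ℂ} (hu : ∀ x, HasDerivAt u (u' x) x) (hu' : Continuous u')
    (hg : LocallyIntegrable g volume) (c : ℂ) (x : ℝ) :
    u x * (c + ∫ t in (0 : ℝ)..x, g t) =
      u 0 * c + ∫ t in (0 : ℝ)..x, (u' t * (c + ∫ s in (0 : ℝ)..t, g s) + u t * g t) := by
  have hgi (a b : ℝ) : IntervalIntegrable g volume a b :=
    (hg.integrableOn_isCompact isCompact_uIcc).intervalIntegrable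
  have huc : Continuous u := continuous_iff_continuousAt.mpr fun y ↦ (hu y).continuousAt
  have hGc : Continuous fun t ↦ c + ∫ s in (0 : ℝ)..t, g s :=
    continuous_const.add (intervalIntegral.continuous_primitive hgi 0)
  set r : ℝ → ℂ := fun t ↦ u' t * (c + ∫ s in (0 : ℝ)..t, g s) + u t * g t with hr
  have hri : LocallyIntegrable r volume :=
    (hu'.mul hGc).locallyIntegrable.add (hg.continuous_smul huc)
  have hu_ac : AbsolutelyContinuousOnInterval u 0 x := by
    refine ContDiffOn.absolutelyContinuousOnInterval (ContDiff.contDiffOn ?_)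
    rw [contDiff_one_iff_deriv]
    exact ⟨fun y ↦ (hu y).differentiableAt, by rwa [show deriv u = u' from funext fun y ↦ (hu y).deriv]⟩
  have hD := (hu_ac.fun_smul ((absolutelyContinuousOnInterval_const c 0 x).add
    (hg.absolutelyContinuousOnInterval_integral 0 x))).sub
    (hri.absolutelyContinuousOnInterval_integral 0 x)
  -- The difference of the two sides is absolutely continuous with derivative zero almost
  -- everywhere, hence constant; the endpoints `x` and `0` are then compared.
  obtain ⟨C, hC⟩ := hD.const_of_ae_hasDerivAt_zero (by
    filter_upwards [LocallyIntegrable.ae_hasDerivAt_integral hg,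
      LocallyIntegrable.ae_hasDerivAt_integral hri] with y h1 h2 _
    have h3 := ((hu y).mul ((h1 0).const_add c)).sub (h2 0)
    refine (h3.congr_deriv ?_).congr_of_eventuallyEq (.of_forall fun z ↦ ?_)
    · simp [hr]
    · simp)
  have e1 := hC x (by simp)
  have e2 := hC 0 (by simp)
  simp only [Pi.sub_apply, Pi.add_apply, smul_eq_mul, intervalIntegral.integral_same, add_zero,
    sub_zero] at e1 e2
  linear_combination e1 - e2

end ProductRule

/-! ### First order equations with periodic coefficient in `L²`. -/

section FirstOrder

lemma Function.Periodic.primitive_add {ψ : ℝ → ℂ} {T : ℝ} (hc : Continuous ψ)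
    (hp : Function.Periodic ψ T) (x : ℝ) :
    ∫ t in (0 : ℝ)..x + T, ψ t = (∫ t in (0 : ℝ)..x, ψ t) + ∫ t in (0 : ℝ)..T, ψ t := by
  have h := hp.intervalIntegral_add_eq x 0
  rw [zero_add] at h
  rw [← h, intervalIntegral.integral_add_adjacent_intervals] <;>
    exact hc.intervalIntegrable _ _

lemma hasDerivAt_primitive {ψ : ℝ → ℂ} (hc : Continuous ψ) (x : ℝ) :
    HasDerivAt (fun x ↦ ∫ t in (0 : ℝ)..x, ψ t) (ψ x) x :=
  intervalIntegral.integral_hasDerivAt_right (hc.intervalIntegrable _ _)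
    (hc.stronglyMeasurableAtFilter _ _) hc.continuousAt

/-- Removing the mean drift from the primitive leaves a continuous periodic function. -/
lemma Function.Periodic.exists_abs_re_primitive_sub_le {ψ : ℝ → ℂ} {T : ℝ} (hT : T ≠ 0)
    (hc : Continuous ψ) (hp : Function.Periodic ψ T) :
    ∃ B, ∀ x, |(∫ t in (0 : ℝ)..x, ψ t).re - (∫ t in (0 : ℝ)..T, ψ t).re / T * x| ≤ B := by
  set r : ℝ → ℝ := fun x ↦
    (∫ t in (0 : ℝ)..x, ψ t).re - (∫ t in (0 : ℝ)..T, ψ t).re / T * x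
  have hcont : Continuous r :=
    (Complex.continuous_re.comp (continuous_iff_continuousAt.mpr fun x ↦
      (hasDerivAt_primitive hc x).continuousAt)).sub (by fun_prop)
  have hper : Function.Periodic r T := by
    intro x
    simp only [r, hp.primitive_add hc x, Complex.add_re]
    field_simp
    ring
  obtain ⟨B, hB⟩ := (hper.isBounded_of_continuous hT hcont).exists_norm_le
  exact ⟨B, fun x ↦ by simpa using hB (r x) (mem_range_self x)⟩

/-- The first order equation `f' = ψ f + g` with periodic `ψ` is boundedly solvable in `L²` when
the mean of `ψ` has negative real part. -/
lemma exists_first_order_solution_of_neg {ψ : ℝ → ℂ} {T : ℝ} (hT : 0 < T) (hc : Continuous ψ)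
    (hp : Function.Periodic ψ T) (hneg : (∫ t in (0 : ℝ)..T, ψ t).re < 0) :
    ∃ C : NNReal, ∀ g : ℝ → ℂ, MemLp g 2 volume → ∃ f : ℝ → ℂ, Continuous f ∧
      eLpNorm f 2 volume ≤ C * eLpNorm g 2 volume ∧
      ∀ x, f x = f 0 + ∫ t in (0 : ℝ)..x, (ψ t * f t + g t) := by
  obtain ⟨B, hB⟩ := hp.exists_abs_re_primitive_sub_le hT.ne' hc
  set Ψ : ℝ → ℂ := fun x ↦ ∫ t in (0 : ℝ)..x, ψ t with hΨ
  set m : ℝ := (∫ t in (0 : ℝ)..T, ψ t).re / T with hm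
  have hm0 : m < 0 := div_neg_of_neg_of_pos hneg hT
  have hΨd (x : ℝ) : HasDerivAt Ψ (ψ x) x := hasDerivAt_primitive hc x
  have hΨc : Continuous Ψ := continuous_iff_continuousAt.mpr fun x ↦ (hΨd x).continuousAt
  have hle (x y : ℝ) : (Ψ x - Ψ y).re ≤ 2 * B + m * (x - y) := by
    have h1 := (abs_le.mp (hB x)).2
    have h2 := (abs_le.mp (hB y)).1
    rw [Complex.sub_re]
    linarith
  -- The solution is `f(x) = ∫_{y ≤ x} exp(Ψ(x) - Ψ(y)) g(y) dy`. By `hle` its kernel is dominated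
  -- by `K(x - y)`, integrable because `m < 0`.
  set K : ℝ → ENNReal :=
    (Ici (0 : ℝ)).indicator fun t ↦ ENNReal.ofReal (Real.exp (2 * B) * Real.exp (m * t)) with hK
  have hKm : Measurable K := Measurable.indicator (by fun_prop) measurableSet_Ici
  have hKfin : ∫⁻ t, K t < ⊤ := by
    rw [hK, lintegral_indicator measurableSet_Ici, setLIntegral_congr Ioi_ae_eq_Ici.symm]
    exact ((integrableOn_exp_mul_Ioi hm0 0).const_mul (Real.exp (2 * B))).lintegral_lt_top
  refine ⟨(∫⁻ t, K t).toNNReal, fun g hg ↦ ?_⟩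
  set h : ℝ → ℂ := fun y ↦ Complex.exp (-Ψ y) * g y with hh
  have hexpc : Continuous fun y ↦ Complex.exp (-Ψ y) := by fun_prop
  have hexp_mem (x : ℝ) : MemLp (fun y ↦ Complex.exp (-Ψ y)) 2 (volume.restrict (Iic x)) := by
    rw [memLp_two_iff_integrable_sq_norm hexpc.aestronglyMeasurable]
    refine (((integrableOn_exp_mul_Iic (a := 2 * -m) (by linarith) x).const_mul
      (Real.exp (2 * (2 * B))))).mono (by fun_prop) (.of_forall fun y ↦ ?_)
    rw [Complex.norm_exp, ← Real.exp_nat_mul, ← Real.exp_add, Real.norm_eq_abs, Real.norm_eq_abs,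
      Real.abs_exp, Real.abs_exp, Real.exp_le_exp]
    have := hle 0 y
    have h0 : Ψ 0 = 0 := intervalIntegral.integral_same
    rw [h0, zero_sub] at this
    push_cast
    linarith
  have hint (x : ℝ) : IntegrableOn h (Iic x) :=
    (hexp_mem x).integrable_mul (hg.mono_measure Measure.restrict_le_self)
  have hloc : LocallyIntegrable h volume :=
    (hg.locallyIntegrable one_le_two).continuous_smul hexpc
  set f : ℝ → ℂ := fun x ↦ Complex.exp (Ψ x) * ∫ y in Iic x, h y with hf
  have hsplit (x : ℝ) : ∫ y in Iic x, h y = (∫ y in Iic 0, h y) + ∫ y in (0 : ℝ)..x, h y := by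
    rw [← intervalIntegral.integral_Iic_sub_Iic (hint 0) (hint x)]; ring
  have hii (a b : ℝ) : IntervalIntegrable h volume a b :=
    (hloc.integrableOn_isCompact isCompact_uIcc).intervalIntegrable
  have hf' (t : ℝ) : f t = Complex.exp (Ψ t) * ((∫ y in Iic 0, h y) + ∫ y in (0 : ℝ)..t, h y) := by
    rw [← hsplit]
  refine ⟨f, ?_, ?_, ?_⟩
  · rw [funext hf']
    exact (by fun_prop : Continuous fun x ↦ Complex.exp (Ψ x)).mul
      (continuous_const.add (intervalIntegral.continuous_primitive hii 0))
  · rw [ENNReal.coe_toNNReal hKfin.ne]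
    refine eLpNorm_two_le_of_enorm_le_convolution hKm hg.1 fun x ↦ ?_
    rw [hf, enorm_mul]
    calc ‖Complex.exp (Ψ x)‖ₑ * ‖∫ y in Iic x, h y‖ₑ
        ≤ ‖Complex.exp (Ψ x)‖ₑ * ∫⁻ y in Iic x, ‖h y‖ₑ := by
          gcongr; exact enorm_integral_le_lintegral_enorm _
      _ = ∫⁻ y in Iic x, ‖Complex.exp (Ψ x)‖ₑ * ‖h y‖ₑ := by
          rw [lintegral_const_mul'']
          exact (hint x).aestronglyMeasurable.enorm
      _ ≤ ∫⁻ y in Iic x, K (x - y) * ‖g y‖ₑ := by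
          refine setLIntegral_mono' measurableSet_Iic fun y hy ↦ ?_
          rw [hh, enorm_mul, ← mul_assoc, ← enorm_mul, ← Complex.exp_add]
          gcongr
          rw [hK, indicator_of_mem (mem_Ici.mpr (sub_nonneg.mpr hy)), ← ofReal_norm,
            Complex.norm_exp, ← Real.exp_add]
          exact ENNReal.ofReal_le_ofReal (Real.exp_le_exp.mpr (hle x y))
      _ ≤ ∫⁻ y, K (x - y) * ‖g y‖ₑ := setLIntegral_le_lintegral _ _
  · intro x
    have hud (x : ℝ) : HasDerivAt (fun x ↦ Complex.exp (Ψ x)) (Complex.exp (Ψ x) * ψ x) x :=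
      (hΨd x).cexp
    have := mul_primitive_eq hud (by fun_prop) hloc (∫ y in Iic 0, h y) x
    rw [hf' x, this, hf' 0, intervalIntegral.integral_same, add_zero]
    congr 1
    refine intervalIntegral.integral_congr fun t _ ↦ ?_
    simp only [hf' t, hh]
    rw [← mul_assoc (Complex.exp (Ψ t)) (Complex.exp (-Ψ t)), ← Complex.exp_add]
    simp only [add_neg_cancel, Complex.exp_zero]
    ring

/-- The reflection `x ↦ -x` reverses the sign of the mean and reduces the positive case to the
negative one. -/
lemma exists_first_order_solution {ψ : ℝ → ℂ} {T : ℝ} (hT : 0 < T) (hc : Continuous ψ)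
    (hp : Function.Periodic ψ T) (hne : (∫ t in (0 : ℝ)..T, ψ t).re ≠ 0) :
    ∃ C : NNReal, ∀ g : ℝ → ℂ, MemLp g 2 volume → ∃ f : ℝ → ℂ, Continuous f ∧
      eLpNorm f 2 volume ≤ C * eLpNorm g 2 volume ∧
      ∀ x, f x = f 0 + ∫ t in (0 : ℝ)..x, (ψ t * f t + g t) := by
  rcases hne.lt_or_gt with hneg | hpos
  · exact exists_first_order_solution_of_neg hT hc hp hneg
  have hint : ∫ t in (0 : ℝ)..T, -ψ (-t) = -∫ t in (0 : ℝ)..T, ψ t := by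
    rw [intervalIntegral.integral_neg, intervalIntegral.integral_comp_neg]
    have := hp.intervalIntegral_add_eq (-T) 0
    simp only [neg_add_cancel, zero_add] at this
    rw [neg_zero, this]
  obtain ⟨C, hC⟩ := exists_first_order_solution_of_neg (ψ := fun t ↦ -ψ (-t)) hT (by fun_prop)
    (fun t ↦ by
      have := hp (-t - T)
      simp only [sub_add_cancel] at this
      simp only [neg_add', this]) (by rw [hint]; simpa using hpos)
  have hmp : MeasurePreserving (fun x : ℝ ↦ -x) volume volume :=
    Measure.measurePreserving_neg volume
  refine ⟨C, fun g hg ↦ ?_⟩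
  obtain ⟨f, hfc, hfn, hf⟩ := hC (fun t ↦ -g (-t)) (hg.comp_measurePreserving hmp).neg
  refine ⟨fun x ↦ f (-x), by fun_prop, ?_, fun x ↦ ?_⟩
  · have e1 : eLpNorm (fun x ↦ f (-x)) 2 volume = eLpNorm f 2 volume :=
      eLpNorm_comp_measurePreserving hfc.aestronglyMeasurable hmp
    have e2 : eLpNorm (fun x ↦ -g (-x)) 2 volume = eLpNorm g 2 volume :=
      (eLpNorm_neg (fun x ↦ g (-x)) 2 volume).trans (eLpNorm_comp_measurePreserving hg.1 hmp)
    rwa [e1, ← e2]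
  · simp only [neg_zero]
    rw [hf (-x)]
    congr 1
    have := intervalIntegral.integral_comp_neg (a := 0) (b := x)
      (fun t ↦ -ψ (-t) * f t + -g (-t))
    rw [neg_zero] at this
    rw [intervalIntegral.integral_symm, ← this, ← intervalIntegral.integral_neg]
    refine intervalIntegral.integral_congr fun t _ ↦ ?_
    simp only [neg_neg]
    ring

end FirstOrder

/-! ### Linearity of the operator graph and a criterion for the resolvent set. -/

section Graph

lemma L2Line.intervalIntegrable (h : L2Line) (a b : ℝ) : IntervalIntegrable h volume a b :=
  (((Lp.memLp h).locallyIntegrable one_le_two).integrableOn_isCompact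
    isCompact_uIcc).intervalIntegrable

lemma HasSecondDerivL2.add_smul {f₁ f₂ h₁ h₂ : L2Line} (H₁ : HasSecondDerivL2 f₁ h₁)
    (H₂ : HasSecondDerivL2 f₂ h₂) (c : ℂ) : HasSecondDerivL2 (f₁ + c • f₂) (h₁ + c • h₂) := by
  obtain ⟨u₁, v₁, hu₁, hv₁, hi₁⟩ := H₁
  obtain ⟨u₂, v₂, hu₂, hv₂, hi₂⟩ := H₂
  refine ⟨fun x ↦ u₁ x + c * u₂ x, fun x ↦ v₁ x + c * v₂ x, ?_,
    fun x ↦ (hv₁ x).add ((hv₂ x).const_mul c), fun x ↦ ?_⟩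
  · filter_upwards [hu₁, hu₂, Lp.coeFn_add f₁ (c • f₂), Lp.coeFn_smul c f₂] with x e1 e2 e3 e4
    rw [e3, Pi.add_apply, e4, Pi.smul_apply, e1, e2, smul_eq_mul]
  · have hae : ∀ᵐ t, (h₁ + c • h₂ : L2Line) t = h₁ t + c * h₂ t := by
      filter_upwards [Lp.coeFn_add h₁ (c • h₂), Lp.coeFn_smul c h₂] with t e3 e4
      rw [e3, Pi.add_apply, e4, Pi.smul_apply, smul_eq_mul]
    rw [intervalIntegral.integral_congr_ae (hae.mono fun t ht _ ↦ ht),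
      intervalIntegral.integral_add (h₁.intervalIntegrable _ _)
        ((h₂.intervalIntegrable _ _).const_mul c), intervalIntegral.integral_const_mul]
    linear_combination hi₁ x + c * hi₂ x

variable {q : ℝ → ℂ} {lam : ℂ}

lemma SchrodingerGraph.add_smul {f₁ f₂ g₁ g₂ : L2Line} (H₁ : SchrodingerGraph q f₁ g₁)
    (H₂ : SchrodingerGraph q f₂ g₂) (c : ℂ) : SchrodingerGraph q (f₁ + c • f₂) (g₁ + c • g₂) := by
  obtain ⟨h₁, hh₁, e₁⟩ := H₁
  obtain ⟨h₂, hh₂, e₂⟩ := H₂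
  refine ⟨h₁ + c • h₂, hh₁.add_smul hh₂ c, ?_⟩
  filter_upwards [e₁, e₂, Lp.coeFn_add f₁ (c • f₂), Lp.coeFn_smul c f₂,
    Lp.coeFn_add g₁ (c • g₂), Lp.coeFn_smul c g₂, Lp.coeFn_add h₁ (c • h₂),
    Lp.coeFn_smul c h₂] with x e1 e2 e3 e4 e5 e6 e7 e8
  rw [e5, e7, e3, Pi.add_apply, Pi.add_apply, Pi.add_apply, e4, e6, e8]
  simp only [Pi.smul_apply, smul_eq_mul, e1, e2]
  ring

/-- Injectivity makes the chosen solutions unique, and uniqueness makes the solution map linear. -/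
lemma mem_schrodingerResolventSet_of_forall_exists (C : ℝ)
    (hex : ∀ g : L2Line, ∃ f : L2Line, ‖f‖ ≤ C * ‖g‖ ∧ SchrodingerGraph q f (g + lam • f))
    (hun : ∀ f : L2Line, SchrodingerGraph q f (lam • f) → f = 0) :
    lam ∈ schrodingerResolventSet q := by
  have huniq {g f₁ f₂ : L2Line} (h₁ : SchrodingerGraph q f₁ (g + lam • f₁))
      (h₂ : SchrodingerGraph q f₂ (g + lam • f₂)) : f₁ = f₂ := by
    have h := h₁.add_smul h₂ (-1)
    have e : g + lam • f₁ + (-1 : ℂ) • (g + lam • f₂) = lam • (f₁ + (-1 : ℂ) • f₂) := by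
      module
    rw [e] at h
    have := hun _ h
    rwa [neg_one_smul, ← sub_eq_add_neg, sub_eq_zero] at this
  choose F hFn hF using hex
  have hlin (a : ℂ) (g₁ g₂ : L2Line) : F (g₁ + a • g₂) = F g₁ + a • F g₂ := by
    refine huniq (hF _) ?_
    have h := (hF g₁).add_smul (hF g₂) a
    have e : g₁ + lam • F g₁ + a • (g₂ + lam • F g₂)
        = g₁ + a • g₂ + lam • (F g₁ + a • F g₂) := by module
    rwa [e] at h
  have h0 : F 0 = 0 := by
    have := hlin 1 0 0
    simpa using this
  let T : L2Line →ₗ[ℂ] L2Line :=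
    { toFun := F
      map_add' := fun a b ↦ by simpa using hlin 1 a b
      map_smul' := fun a b ↦ by simpa [h0] using hlin a 0 b }
  refine ⟨T.mkContinuous C hFn, fun f g ↦ ⟨?_, fun h ↦ huniq (hF g) h⟩⟩
  rintro rfl
  exact hF g

end Graph

/-! ### Spectrum and resolvent set from a periodic Riccati solution. -/

section Riccati

variable {q φ φ' : ℝ → ℂ} {lam : ℂ} {T : ℝ}

lemma toLp_ae_eq {f : ℝ → ℂ} (hf : MemLp f 2 volume) :
    ((hf.toLp f : L2Line) : ℝ → ℂ) =ᵐ[volume] f := hf.coeFn_toLp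

lemma memLp_mul_of_bounded {b f : ℝ → ℂ} (hb : Continuous b) {B : ℝ} (hB : ∀ x, ‖b x‖ ≤ B)
    (hf : MemLp f 2 volume) : MemLp (fun x ↦ b x * f x) 2 volume :=
  hf.of_le_mul (hb.aestronglyMeasurable.mul hf.1) (.of_forall fun x ↦ by
    rw [norm_mul]
    exact mul_le_mul_of_nonneg_right (hB x) (norm_nonneg _))

lemma Function.Periodic.exists_norm_le {b : ℝ → ℂ} (hp : Function.Periodic b T) (hT : T ≠ 0)
    (hb : Continuous b) : ∃ B, ∀ x, ‖b x‖ ≤ B := by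
  obtain ⟨B, hB⟩ := (hp.isBounded_of_continuous hT hb).exists_norm_le
  exact ⟨B, fun x ↦ hB _ (mem_range_self x)⟩

/-- A bounded right inverse of `-d²/dx² + q - lam = -(d/dx + φ)(d/dx - φ)`. -/
lemma exists_schrodingerGraph_of_riccati (hT : 0 < T) (hq : Continuous q)
    (hqp : Function.Periodic q T) (hφ : ∀ x, HasDerivAt φ (φ' x) x)
    (hφp : Function.Periodic φ T) (hR : ∀ x, φ' x + φ x ^ 2 = q x - lam)
    (hM : (∫ t in (0 : ℝ)..T, φ t).re ≠ 0) :
    ∃ C : ℝ, ∀ g : L2Line, ∃ f : L2Line, ‖f‖ ≤ C * ‖g‖ ∧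
      SchrodingerGraph q f (g + lam • f) := by
  have hφc : Continuous φ := continuous_iff_continuousAt.mpr fun y ↦ (hφ y).continuousAt
  have hφ'c : Continuous φ' := by
    rw [show φ' = fun x ↦ q x - lam - φ x ^ 2 from funext fun x ↦ by rw [← hR x]; ring]
    fun_prop
  obtain ⟨C₁, hC₁⟩ := exists_first_order_solution hT hφc hφp hM
  obtain ⟨C₂, hC₂⟩ := exists_first_order_solution (ψ := fun x ↦ -φ x) hT hφc.neg
    (fun x ↦ by simp only [hφp x]) (by
      rw [intervalIntegral.integral_neg, Complex.neg_re]; exact neg_ne_zero.mpr hM)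
  obtain ⟨B, hB⟩ := hqp.exists_norm_le hT.ne' hq
  -- The two factors are inverted in turn: `p' = -φp - g`, then `f' = φf + p`.
  refine ⟨C₁ * C₂, fun g ↦ ?_⟩
  obtain ⟨p, hpc, hpn, hp⟩ := hC₂ (fun x ↦ -g x) (Lp.memLp g).neg
  have hgn : eLpNorm (fun x ↦ -g x) 2 volume = eLpNorm g 2 volume := eLpNorm_neg (⇑g) 2 volume
  rw [hgn] at hpn
  have hpm : MemLp p 2 volume := ⟨hpc.aestronglyMeasurable, hpn.trans_lt
    (ENNReal.mul_lt_top ENNReal.coe_lt_top (Lp.memLp g).2)⟩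
  obtain ⟨f, hfc, hfn, hf⟩ := hC₁ p hpm
  have hfm : MemLp f 2 volume := ⟨hfc.aestronglyMeasurable, hfn.trans_lt
    (ENNReal.mul_lt_top ENNReal.coe_lt_top hpm.2)⟩
  have hfd (x : ℝ) : HasDerivAt f (φ x * f x + p x) x := by
    refine ((hasDerivAt_primitive (ψ := fun t ↦ φ t * f t + p t) (by fun_prop) x).const_add
      (f 0)).congr_of_eventuallyEq (.of_forall fun y ↦ hf y)
  have hhm : MemLp (fun x ↦ (q x - lam) * f x - g x) 2 volume :=
    (memLp_mul_of_bounded (hq.sub continuous_const) (B := B + ‖lam‖) (fun x ↦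
      (norm_sub_le _ _).trans (by gcongr; exact hB x)) hfm).sub (Lp.memLp g)
  refine ⟨hfm.toLp f, ?_, hhm.toLp _, ⟨f, fun x ↦ φ x * f x + p x, toLp_ae_eq hfm, hfd, ?_⟩, ?_⟩
  · rw [Lp.norm_toLp, Lp.norm_def, ← ENNReal.coe_toReal C₁, ← ENNReal.coe_toReal C₂,
      ← ENNReal.toReal_mul, ← ENNReal.toReal_mul]
    refine ENNReal.toReal_mono (ENNReal.mul_ne_top
      (ENNReal.mul_ne_top ENNReal.coe_ne_top ENNReal.coe_ne_top) (Lp.memLp g).2.ne) ?_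
    rw [mul_assoc]
    exact hfn.trans (by gcongr)
  · intro x
    have hprod : φ x * f x = φ 0 * f 0 +
        ∫ t in (0 : ℝ)..x, (φ' t * f t + φ t * (φ t * f t + p t)) := by
      rw [intervalIntegral.integral_eq_sub_of_hasDerivAt
        (f := fun x ↦ φ x * f x) (fun t _ ↦ (hφ t).mul (hfd t))
        (Continuous.intervalIntegrable (by fun_prop) _ _)]
      ring
    have hii : IntervalIntegrable (fun t ↦ -φ t * p t + -g t) volume 0 x :=
      (Continuous.intervalIntegrable (by fun_prop) _ _).add (g.intervalIntegrable 0 x).neg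
    rw [intervalIntegral.integral_congr_ae ((toLp_ae_eq hhm).mono fun t ht _ ↦ ht)]
    beta_reduce
    rw [hprod, hp x, add_add_add_comm, ← intervalIntegral.integral_add
      (Continuous.intervalIntegrable (by fun_prop) _ _) hii]
    congr 1
    refine intervalIntegral.integral_congr fun t _ ↦ ?_
    simp only [← hR t]
    ring
  · filter_upwards [toLp_ae_eq hfm, toLp_ae_eq hhm, Lp.coeFn_add g (lam • hfm.toLp f),
      Lp.coeFn_smul lam (hfm.toLp f)] with x e1 e2 e3 e4
    rw [e3, Pi.add_apply, e4, Pi.smul_apply, e2, e1, smul_eq_mul]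
    ring

/-- Translation preserves the `L²` norm, whereas multiplication by `r` scales it by `‖r‖ ≠ 1`. -/
lemma eq_zero_of_norm_add_period_eq {f : ℝ → ℂ} (hc : Continuous f) (hf : MemLp f 2 volume)
    {r : ℂ} (hr : ‖r‖ ≠ 1) (h : ∀ x, f (x + T) = r * f x) : f = 0 := by
  have e1 : eLpNorm (fun x ↦ f (x + T)) 2 volume = eLpNorm f 2 volume :=
    eLpNorm_comp_measurePreserving hf.1 (measurePreserving_add_right volume T)
  have e2 : eLpNorm (fun x ↦ f (x + T)) 2 volume = ‖r‖ₑ * eLpNorm f 2 volume := by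
    rw [funext h]
    exact eLpNorm_const_smul r f 2 volume
  have h0 : eLpNorm f 2 volume = 0 := by
    by_contra hne
    rw [e1] at e2
    have := (ENNReal.mul_eq_right hne hf.2.ne).mp e2.symm
    exact hr (by simpa [enorm_eq_nnnorm, ← NNReal.coe_inj] using this)
  exact hc.ae_eq_iff_eq volume continuous_zero |>.mp
    ((eLpNorm_eq_zero_iff hf.1 two_ne_zero).mp h0)

lemma eq_const_mul_exp_of_hasDerivAt {ψ w : ℝ → ℂ} (hψ : Continuous ψ)
    (hw : ∀ x, HasDerivAt w (ψ x * w x) x) (x : ℝ) :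
    w x = w 0 * Complex.exp (∫ t in (0 : ℝ)..x, ψ t) := by
  have hd (x : ℝ) : HasDerivAt (fun x ↦ w x * Complex.exp (-∫ t in (0 : ℝ)..x, ψ t)) 0 x :=
    ((hw x).mul (hasDerivAt_primitive hψ x).neg.cexp).congr_deriv (by ring)
  have hconst := is_const_of_deriv_eq_zero (fun x ↦ (hd x).differentiableAt)
    (fun x ↦ (hd x).deriv) x 0
  simp only [intervalIntegral.integral_same, neg_zero, Complex.exp_zero, mul_one] at hconst
  rw [← hconst, mul_assoc, ← Complex.exp_add]
  simp

/-- The function `p = u' - φu` solves `p' = -φp`, so it has multiplier `ρ⁻¹`, but it is not known to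
be in `L²`. Instead `w = u(· + T) - ρ⁻¹u` is in `L²` and solves `w' = φw`, so it has multiplier `ρ`
and vanishes. Then `u` itself has multiplier `ρ⁻¹` and vanishes too. -/
lemma eq_zero_of_schrodingerGraph_of_riccati (hq : Continuous q) (hφ : ∀ x, HasDerivAt φ (φ' x) x)
    (hφp : Function.Periodic φ T) (hR : ∀ x, φ' x + φ x ^ 2 = q x - lam)
    (hM : (∫ t in (0 : ℝ)..T, φ t).re ≠ 0) (f : L2Line)
    (hf : SchrodingerGraph q f (lam • f)) : f = 0 := by
  have hφc : Continuous φ := continuous_iff_continuousAt.mpr fun y ↦ (hφ y).continuousAt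
  obtain ⟨h, ⟨u, v, hfu, huv, hv⟩, hg⟩ := hf
  have huc : Continuous u := continuous_iff_continuousAt.mpr fun y ↦ (huv y).continuousAt
  have hum : MemLp u 2 volume := (Lp.memLp f).ae_eq hfu
  have hvd (x : ℝ) : HasDerivAt v ((q x - lam) * u x) x := by
    have hc : Continuous fun t ↦ (q t - lam) * u t := by fun_prop
    refine ((hasDerivAt_primitive hc x).const_add (v 0)).congr_of_eventuallyEq
      (.of_forall fun y ↦ (hv y).trans ?_)
    congr 1
    refine intervalIntegral.integral_congr_ae ?_
    filter_upwards [hfu, hg, Lp.coeFn_smul lam f] with t e1 e2 e3 _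
    rw [e3, Pi.smul_apply, smul_eq_mul, e1] at e2
    linear_combination e2
  set ρ := Complex.exp (∫ t in (0 : ℝ)..T, φ t) with hρ
  have hρ0 : ρ ≠ 0 := Complex.exp_ne_zero _
  have hρ1 : ‖ρ‖ ≠ 1 := by
    rw [hρ, Complex.norm_exp]
    exact fun e ↦ hM (Real.exp_eq_one_iff _ |>.mp e)
  have hp := eq_const_mul_exp_of_hasDerivAt (ψ := fun x ↦ -φ x) (w := fun x ↦ v x - φ x * u x)
    hφc.neg fun x ↦ ((hvd x).sub ((hφ x).mul (huv x))).congr_deriv (by rw [← hR x]; ring)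
  have hpT (x : ℝ) : v (x + T) - φ (x + T) * u (x + T) = ρ⁻¹ * (v x - φ x * u x) := by
    have e1 := hp (x + T)
    have e2 := hp x
    simp only [intervalIntegral.integral_neg, hφp.primitive_add hφc x] at e1 e2
    rw [e1, e2, neg_add, Complex.exp_add, Complex.exp_neg (∫ t in (0 : ℝ)..T, φ t)]
    ring
  set w : ℝ → ℂ := fun x ↦ u (x + T) - ρ⁻¹ * u x with hw
  have hwd (x : ℝ) : HasDerivAt w (φ x * w x) x := by
    refine (((huv (x + T)).comp_add_const x T).sub ((huv x).const_mul ρ⁻¹)).congr_deriv ?_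
    have := hpT x
    rw [hφp x] at this
    simp only [hw]
    linear_combination this
  have hwm : MemLp w 2 volume :=
    (hum.comp_measurePreserving (measurePreserving_add_right volume T)).sub (hum.const_mul ρ⁻¹)
  have hw0 : w = 0 := by
    refine eq_zero_of_norm_add_period_eq (T := T)
      (continuous_iff_continuousAt.mpr fun y ↦ (hwd y).continuousAt) hwm hρ1 fun x ↦ ?_
    rw [eq_const_mul_exp_of_hasDerivAt hφc hwd (x + T), eq_const_mul_exp_of_hasDerivAt hφc hwd x,
      hφp.primitive_add hφc x, Complex.exp_add]
    ring
  have hu0 : u = 0 := by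
    refine eq_zero_of_norm_add_period_eq (T := T) huc hum (r := ρ⁻¹) ?_ fun x ↦ ?_
    · rw [norm_inv]
      exact fun e ↦ hρ1 (inv_eq_one.mp e)
    · exact sub_eq_zero.mp (congrFun hw0 x)
  rw [hu0] at hfu
  exact (Lp.eq_zero_iff_ae_eq_zero).mpr hfu

lemma mem_schrodingerResolventSet_of_riccati (hT : 0 < T) (hq : Continuous q)
    (hqp : Function.Periodic q T) (hφ : ∀ x, HasDerivAt φ (φ' x) x)
    (hφp : Function.Periodic φ T) (hR : ∀ x, φ' x + φ x ^ 2 = q x - lam)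
    (hM : (∫ t in (0 : ℝ)..T, φ t).re ≠ 0) :
    lam ∈ schrodingerResolventSet q := by
  obtain ⟨C, hC⟩ := exists_schrodingerGraph_of_riccati hT hq hqp hφ hφp hR hM
  exact mem_schrodingerResolventSet_of_forall_exists C hC
    (eq_zero_of_schrodingerGraph_of_riccati hq hφ hφp hR hM)

/-- The Lorentzian is a convenient cutoff: its first two derivatives are bounded pointwise by a
multiple of `ε` times the function itself, so the error of an approximate eigenfunction is
controlled without computing any norm. -/
lemma hasDerivAt_lorentzian (ε x : ℝ) :
    HasDerivAt (fun x : ℝ ↦ (1 + ε ^ 2 * x ^ 2)⁻¹)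
      (-(2 * ε ^ 2 * x) / (1 + ε ^ 2 * x ^ 2) ^ 2) x := by
  have hD : 1 + ε ^ 2 * x ^ 2 ≠ 0 := by positivity
  have := ((((hasDerivAt_id x).pow 2).const_mul (ε ^ 2)).const_add 1).inv
    (by simpa using hD)
  refine this.congr_deriv ?_
  simp
  ring

lemma hasDerivAt_deriv_lorentzian (ε x : ℝ) :
    HasDerivAt (fun x : ℝ ↦ -(2 * ε ^ 2 * x) / (1 + ε ^ 2 * x ^ 2) ^ 2)
      ((6 * ε ^ 4 * x ^ 2 - 2 * ε ^ 2) / (1 + ε ^ 2 * x ^ 2) ^ 3) x := by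
  have hD : 1 + ε ^ 2 * x ^ 2 ≠ 0 := by positivity
  have h1 := ((((hasDerivAt_id x).pow 2).const_mul (ε ^ 2)).const_add 1).pow 2
  have h2 := ((hasDerivAt_id x).const_mul (2 * ε ^ 2)).neg
  refine (h2.div h1 (by simpa using hD)).congr_deriv ?_
  simp
  field_simp
  ring

lemma abs_deriv_lorentzian_le {ε : ℝ} (hε : 0 < ε) (x : ℝ) :
    |-(2 * ε ^ 2 * x) / (1 + ε ^ 2 * x ^ 2) ^ 2| ≤ ε * (1 + ε ^ 2 * x ^ 2)⁻¹ := by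
  have hD : 0 < 1 + ε ^ 2 * x ^ 2 := by positivity
  rw [abs_div, abs_of_pos (pow_pos hD 2), ← div_eq_mul_inv, div_le_div_iff₀ (by positivity) hD,
    abs_neg, abs_mul, abs_of_pos (by positivity : 0 < 2 * ε ^ 2)]
  have h : 2 * (ε * |x|) ≤ 1 + ε ^ 2 * x ^ 2 := by
    nlinarith [sq_nonneg (1 - ε * |x|), sq_abs x]
  calc 2 * ε ^ 2 * |x| * (1 + ε ^ 2 * x ^ 2)
      = ε * (1 + ε ^ 2 * x ^ 2) * (2 * (ε * |x|)) := by ring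
    _ ≤ ε * (1 + ε ^ 2 * x ^ 2) * (1 + ε ^ 2 * x ^ 2) := by gcongr
    _ = _ := by ring

lemma abs_deriv_deriv_lorentzian_le {ε : ℝ} (hε : 0 < ε) (hε1 : ε ≤ 1) (x : ℝ) :
    |(6 * ε ^ 4 * x ^ 2 - 2 * ε ^ 2) / (1 + ε ^ 2 * x ^ 2) ^ 3| ≤
      6 * ε * (1 + ε ^ 2 * x ^ 2)⁻¹ := by
  set y := ε ^ 2 * x ^ 2 with hy
  have hy0 : 0 ≤ y := by positivity
  have hD : 0 < 1 + y := by positivity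
  rw [abs_div, abs_of_pos (pow_pos hD 3), ← div_eq_mul_inv, div_le_div_iff₀ (by positivity) hD]
  have h1 : |6 * ε ^ 4 * x ^ 2 - 2 * ε ^ 2| ≤ 6 * ε * (1 + y) := by
    have e : 6 * ε ^ 4 * x ^ 2 - 2 * ε ^ 2 = ε ^ 2 * (6 * y - 2) := by rw [hy]; ring
    rw [e, abs_mul, abs_of_pos (by positivity : 0 < ε ^ 2)]
    have h2 : |6 * y - 2| ≤ 6 * (1 + y) := abs_le.mpr ⟨by linarith, by linarith⟩
    calc ε ^ 2 * |6 * y - 2| ≤ ε * (6 * (1 + y)) := by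
          gcongr
          nlinarith
      _ = _ := by ring
  calc |6 * ε ^ 4 * x ^ 2 - 2 * ε ^ 2| * (1 + y) ≤ 6 * ε * (1 + y) * (1 + y) := by gcongr
    _ = 6 * ε * (1 + y) ^ 2 := by ring
    _ ≤ 6 * ε * (1 + y) ^ 3 := by
      gcongr 6 * ε * ?_
      exact pow_le_pow_right₀ (by linarith) (by norm_num)

lemma memLp_lorentzian {ε : ℝ} (hε : 0 < ε) :
    MemLp (fun x : ℝ ↦ (((1 + ε ^ 2 * x ^ 2)⁻¹ : ℝ) : ℂ)) 2 volume := by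
  have hc : Continuous fun x : ℝ ↦ (((1 + ε ^ 2 * x ^ 2)⁻¹ : ℝ) : ℂ) :=
    Complex.continuous_ofReal.comp ((by fun_prop : Continuous fun x : ℝ ↦ 1 + ε ^ 2 * x ^ 2).inv₀
      fun x ↦ by positivity)
  rw [memLp_two_iff_integrable_sq_norm hc.aestronglyMeasurable]
  refine (integrable_inv_one_add_sq.comp_mul_left' hε.ne').mono
    (hc.norm.pow 2).aestronglyMeasurable (.of_forall fun x ↦ ?_)
  have hD : 1 ≤ 1 + ε ^ 2 * x ^ 2 := by nlinarith [mul_nonneg (sq_nonneg ε) (sq_nonneg x)]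
  have hD0 : 0 < (1 + ε ^ 2 * x ^ 2)⁻¹ := by positivity
  rw [Complex.norm_real, Real.norm_of_nonneg hD0.le, Real.norm_of_nonneg (by positivity),
    mul_pow, Real.norm_of_nonneg hD0.le]
  exact pow_le_of_le_one hD0.le (inv_le_one_of_one_le₀ hD) two_ne_zero

/-- A bounded Floquet solution gives approximate eigenfunctions. -/
lemma exists_approximate_eigenfunction_of_riccati (hT : 0 < T) (hq : Continuous q)
    (hqp : Function.Periodic q T) (hφ : ∀ x, HasDerivAt φ (φ' x) x)
    (hφp : Function.Periodic φ T) (hR : ∀ x, φ' x + φ x ^ 2 = q x - lam)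
    (hM : (∫ t in (0 : ℝ)..T, φ t).re = 0) :
    ∃ C : ℝ, ∀ ε : ℝ, 0 < ε → ε ≤ 1 → ∃ f g : L2Line, f ≠ 0 ∧ ‖g‖ ≤ C * ε * ‖f‖ ∧
      SchrodingerGraph q f (g + lam • f) := by
  have hφc : Continuous φ := continuous_iff_continuousAt.mpr fun y ↦ (hφ y).continuousAt
  obtain ⟨B, hB⟩ := hφp.exists_norm_le hT.ne' hφc
  obtain ⟨Bq, hBq⟩ := hqp.exists_norm_le hT.ne' hq
  obtain ⟨M, hMb⟩ := hφp.exists_abs_re_primitive_sub_le hT.ne' hφc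
  simp only [hM, zero_div, zero_mul, sub_zero] at hMb
  set U : ℝ → ℂ := fun x ↦ Complex.exp (∫ t in (0 : ℝ)..x, φ t) with hU
  have hUd (x : ℝ) : HasDerivAt U (φ x * U x) x :=
    (hasDerivAt_primitive hφc x).cexp.congr_deriv (mul_comm _ _)
  have hUc : Continuous U := continuous_iff_continuousAt.mpr fun y ↦ (hUd y).continuousAt
  have hUb (x : ℝ) : ‖U x‖ ≤ Real.exp M := by
    rw [hU, Complex.norm_exp]
    exact Real.exp_le_exp.mpr (abs_le.mp (hMb x)).2
  refine ⟨6 + 2 * B, fun ε hε hε1 ↦ ?_⟩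
  set χ : ℝ → ℂ := fun x ↦ (((1 + ε ^ 2 * x ^ 2)⁻¹ : ℝ) : ℂ) with hχ
  set χ₁ : ℝ → ℂ := fun x ↦ ((-(2 * ε ^ 2 * x) / (1 + ε ^ 2 * x ^ 2) ^ 2 : ℝ) : ℂ) with hχ₁
  set χ₂ : ℝ → ℂ := fun x ↦
    (((6 * ε ^ 4 * x ^ 2 - 2 * ε ^ 2) / (1 + ε ^ 2 * x ^ 2) ^ 3 : ℝ) : ℂ) with hχ₂
  have hχd (x : ℝ) : HasDerivAt χ (χ₁ x) x := (hasDerivAt_lorentzian ε x).ofReal_comp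
  have hχ₁d (x : ℝ) : HasDerivAt χ₁ (χ₂ x) x := (hasDerivAt_deriv_lorentzian ε x).ofReal_comp
  have hχc : Continuous χ := continuous_iff_continuousAt.mpr fun y ↦ (hχd y).continuousAt
  have hχ₁c : Continuous χ₁ := continuous_iff_continuousAt.mpr fun y ↦ (hχ₁d y).continuousAt
  have hχ₂c : Continuous χ₂ := by
    refine Complex.continuous_ofReal.comp (Continuous.div (by fun_prop) (by fun_prop) fun x ↦ ?_)
    positivity
  have hχn (x : ℝ) : ‖χ x‖ = (1 + ε ^ 2 * x ^ 2)⁻¹ := by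
    rw [hχ, Complex.norm_real, Real.norm_of_nonneg (by positivity)]
  have hχ₁n (x : ℝ) : ‖χ₁ x‖ ≤ ε * ‖χ x‖ := by
    rw [hχn, hχ₁, Complex.norm_real, Real.norm_eq_abs]
    exact abs_deriv_lorentzian_le hε x
  have hχ₂n (x : ℝ) : ‖χ₂ x‖ ≤ 6 * ε * ‖χ x‖ := by
    rw [hχn, hχ₂, Complex.norm_real, Real.norm_eq_abs]
    exact abs_deriv_deriv_lorentzian_le hε hε1 x
  have hfm : MemLp (fun x ↦ U x * χ x) 2 volume :=
    memLp_mul_of_bounded hUc hUb (memLp_lorentzian hε)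
  -- Since `U'' = (q - λ)U`, applying the operator minus `λ` to `Uχ` leaves only the commutator
  -- `-(χ'' + 2φχ')U`.
  have hgle (x : ℝ) : ‖-(χ₂ x + 2 * χ₁ x * φ x) * U x‖ ≤ (6 + 2 * B) * ε * ‖U x * χ x‖ := by
    have hB0 : 0 ≤ B := (norm_nonneg _).trans (hB 0)
    rw [norm_mul, norm_neg, norm_mul (U x)]
    have : ‖χ₂ x + 2 * χ₁ x * φ x‖ ≤ 6 * ε * ‖χ x‖ + 2 * (ε * ‖χ x‖) * B := by
      refine (norm_add_le _ _).trans (add_le_add (hχ₂n x) ?_)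
      rw [norm_mul, norm_mul, Complex.norm_ofNat]
      gcongr
      · exact hχ₁n x
      · exact hB x
    calc _ ≤ (6 * ε * ‖χ x‖ + 2 * (ε * ‖χ x‖) * B) * ‖U x‖ := by gcongr
      _ = _ := by ring
  have hgm : MemLp (fun x ↦ -(χ₂ x + 2 * χ₁ x * φ x) * U x) 2 volume :=
    hfm.of_le_mul (by fun_prop) (.of_forall hgle)
  have hhm : MemLp (fun x ↦ (q x - lam) * (U x * χ x) - -(χ₂ x + 2 * χ₁ x * φ x) * U x) 2
      volume :=
    (memLp_mul_of_bounded (hq.sub continuous_const) (B := Bq + ‖lam‖) (fun x ↦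
      (norm_sub_le _ _).trans (by gcongr; exact hBq x)) hfm).sub hgm
  refine ⟨hfm.toLp _, hgm.toLp _, ?_, ?_, hhm.toLp _, ⟨_, fun x ↦ φ x * U x * χ x + U x * χ₁ x,
    toLp_ae_eq hfm, fun x ↦ (hUd x).mul (hχd x), fun x ↦ ?_⟩, ?_⟩
  · intro h0
    have h1 := (toLp_ae_eq hfm).symm.trans (Lp.eq_zero_iff_ae_eq_zero.mp h0)
    have h2 := congrFun ((hUc.mul hχc).ae_eq_iff_eq volume continuous_zero |>.mp h1) 0
    simp [hU, hχ] at h2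
  · refine Lp.norm_le_mul_norm_of_ae_le_mul ?_
    filter_upwards [toLp_ae_eq hfm, toLp_ae_eq hgm] with x e1 e2
    rw [e1, e2]
    exact hgle x
  · rw [intervalIntegral.integral_congr_ae ((toLp_ae_eq hhm).mono fun t ht _ ↦ ht),
      intervalIntegral.integral_eq_sub_of_hasDerivAt
        (f := fun x ↦ φ x * U x * χ x + U x * χ₁ x) (fun t _ ↦ ?_)
        (Continuous.intervalIntegrable (by fun_prop) _ _)]
    · ring
    · refine ((((hφ t).mul (hUd t)).mul (hχd t)).add ((hUd t).mul (hχ₁d t))).congr_deriv ?_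
      simp only [Pi.mul_apply]
      linear_combination (U t * χ t) * hR t
  · filter_upwards [toLp_ae_eq hfm, toLp_ae_eq hgm, toLp_ae_eq hhm,
      Lp.coeFn_add (hgm.toLp _ : L2Line) (lam • hfm.toLp _),
      Lp.coeFn_smul lam (hfm.toLp _ : L2Line)] with x e1 e2 e3 e4 e5
    rw [e4, Pi.add_apply, e5, Pi.smul_apply, e3, e2, e1, smul_eq_mul]
    ring

lemma mem_schrodingerSpectrum_of_riccati (hT : 0 < T) (hq : Continuous q)
    (hqp : Function.Periodic q T) (hφ : ∀ x, HasDerivAt φ (φ' x) x)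
    (hφp : Function.Periodic φ T) (hR : ∀ x, φ' x + φ x ^ 2 = q x - lam)
    (hM : (∫ t in (0 : ℝ)..T, φ t).re = 0) :
    lam ∈ schrodingerSpectrum q := by
  rintro ⟨R, hRes⟩
  obtain ⟨C, hC⟩ := exists_approximate_eigenfunction_of_riccati hT hq hqp hφ hφp hR hM
  set K : ℝ := ‖R‖ * |C| with hK
  have hK0 : 0 ≤ K := by positivity
  -- With `ε = 1/(K + 1)` a bounded inverse would give `‖f‖ ≤ K/(K + 1) · ‖f‖` with `f ≠ 0`.
  obtain ⟨f, g, hf0, hg, hgraph⟩ := hC (K + 1)⁻¹ (by positivity)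
    (inv_le_one_of_one_le₀ (by linarith))
  have hfpos : 0 < ‖f‖ := norm_pos_iff.mpr hf0
  have h1 : ‖f‖ ≤ ‖R‖ * ‖g‖ := by
    rw [← (hRes f g).mpr hgraph]
    exact R.le_opNorm g
  have h2 : ‖f‖ ≤ K * (K + 1)⁻¹ * ‖f‖ :=
    calc ‖f‖ ≤ ‖R‖ * (C * (K + 1)⁻¹ * ‖f‖) := h1.trans (by gcongr)
      _ ≤ ‖R‖ * (|C| * (K + 1)⁻¹ * ‖f‖) := by gcongr; exact le_abs_self C
      _ = _ := by rw [hK]; ring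
  have h3 : K * (K + 1)⁻¹ < 1 := by
    rw [← div_eq_mul_inv, div_lt_one (by linarith)]; linarith
  nlinarith

end Riccati

/-! ### From an analytic real-positivity condition at infinity to an arc. -/

section Asymptotics

lemma AnalyticAt.isBigO_sub_linear {Q : ℂ → ℂ} (hQ : AnalyticAt ℂ Q 0) :
    (fun w ↦ Q w - (Q 0 + deriv Q 0 * w)) =O[𝓝 0] fun w ↦ w ^ 2 := by
  obtain ⟨p, hp⟩ := hQ
  have h := hp.isBigO_sub_partialSum_pow 2
  refine ((h.congr_left fun w ↦ ?_).trans (isBigO_refl _ _)).trans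
    (isBigO_of_le _ fun w ↦ by simp)
  rw [zero_add, FormalMultilinearSeries.partialSum, Finset.sum_range_succ, Finset.sum_range_one,
    FormalMultilinearSeries.apply_eq_pow_smul_coeff,
    FormalMultilinearSeries.apply_eq_pow_smul_coeff, hp.deriv]
  have : p.coeff 0 = Q 0 := hp.coeff_zero _
  rw [this]
  simp only [FormalMultilinearSeries.coeff]
  simp only [smul_eq_mul, pow_zero, pow_one, one_mul]
  rw [mul_comm w]
  rfl

/-- If, for large `z`, membership in `S` means that `z * Q (1 / z)` is a nonnegative real number,
where `Q` is analytic at `0` with `Q 0 = 1`, then outside a bounded set `S` is an analytic arc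
asymptotic to a half-line. -/
theorem exists_analytic_arc {S : Set ℂ} {Q : ℂ → ℂ} {c : ℂ} {R : ℝ} (hQ : AnalyticAt ℂ Q 0)
    (hQ0 : Q 0 = 1) (hQ1 : deriv Q 0 = c)
    (hS : ∀ z, R < ‖z‖ → (z ∈ S ↔ ∃ t : ℝ, 0 ≤ t ∧ z * Q z⁻¹ = t)) :
    ∃ (δ : ℝ) (lam : ℝ → ℂ), 0 < δ ∧
      AnalyticOnNhd ℝ lam (Ioo 0 δ) ∧
      InjOn lam (Ioo 0 δ) ∧
      (∀ s ∈ Ioo 0 δ, deriv lam s ≠ 0) ∧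
      lam '' Ioo 0 δ ⊆ S ∧
      IsBounded (S \ lam '' Ioo 0 δ) ∧
      AsymptoticAtInfinity (lam '' Ioo 0 δ) (shiftedHalfLine (-c)) ∧
      (fun s : ℝ => lam s - (1 / (s : ℂ) ^ 2 - c)) =O[𝓝[>] 0] (fun s : ℝ => s ^ 2) := by
  -- For `w = 1/z` and `t > 0`, the condition `z Q(1/z) = t` becomes `Φ(w) = 1/t`. As `Φ'(0) = 1`,
  -- it is solved by the local inverse `Ψ`, and `t = 1/s²` gives the arc `1/Ψ(s²)`.
  set Φ : ℂ → ℂ := fun w ↦ w * (Q w)⁻¹ with hΦ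
  have hΦa : AnalyticAt ℂ Φ 0 := analyticAt_id.mul (hQ.inv (by rw [hQ0]; exact one_ne_zero))
  have hΦ0 : Φ 0 = 0 := by simp [hΦ]
  have hΦ1 : deriv Φ 0 ≠ 0 := by
    have h := (hasDerivAt_id (0 : ℂ)).mul
      (hQ.inv (by rw [hQ0]; exact one_ne_zero)).differentiableAt.hasDerivAt
    have h' : HasDerivAt Φ 1 0 := (h.congr_deriv (by simp [hQ0]))
    rw [h'.deriv]
    exact one_ne_zero
  set Ψ : ℂ → ℂ := hΦa.hasStrictDerivAt.localInverse _ _ _ hΦ1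
  have hΨa : AnalyticAt ℂ Ψ 0 := hΦ0 ▸ hΦa.analyticAt_localInverse hΦ1
  have hΨ0 : Ψ 0 = 0 := by
    have := HasStrictFDerivAt.localInverse_apply_image
      (hΦa.hasStrictDerivAt.hasStrictFDerivAt_equiv hΦ1)
    rwa [hΦ0] at this
  have hright : ∀ᶠ y in 𝓝 (0 : ℂ), Φ (Ψ y) = y :=
    hΦ0 ▸ HasStrictDerivAt.eventually_right_inverse hΦa.hasStrictDerivAt hΦ1
  have hleft : ∀ᶠ w in 𝓝 (0 : ℂ), Ψ (Φ w) = w :=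
    HasStrictDerivAt.eventually_left_inverse hΦa.hasStrictDerivAt hΦ1
  obtain ⟨K, hK0, hK⟩ := hQ.isBigO_sub_linear.exists_nonneg
  rw [IsBigOWith_def] at hK
  have hQlo : ∀ᶠ w in 𝓝 (0 : ℂ), 1 / 2 < ‖Q w‖ :=
    hQ.continuousAt.norm.eventually (lt_mem_nhds (by simp only [hQ0]; norm_num))
  have hQhi : ∀ᶠ w in 𝓝 (0 : ℂ), ‖Q w‖ < 2 :=
    hQ.continuousAt.norm.eventually (gt_mem_nhds (by simp only [hQ0]; norm_num))
  have hRw : ∀ᶠ w in 𝓝 (0 : ℂ), R * ‖w‖ < 1 :=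
    (by fun_prop : Continuous fun w : ℂ ↦ R * ‖w‖).continuousAt.eventually
      (gt_mem_nhds (by simp))
  obtain ⟨ρ, hρ, hball⟩ := Metric.eventually_nhds_iff_ball.mp
    (hleft.and (hK.and (hQlo.and (hQhi.and (hRw.and hΦa.eventually_analyticAt)))))
  obtain ⟨d, hd, hball'⟩ := Metric.eventually_nhds_iff_ball.mp
    (hright.and (hΨa.eventually_analyticAt.and
      (hΨa.continuousAt.eventually (Metric.isOpen_ball.mem_nhds
        (show Ψ 0 ∈ Metric.ball 0 ρ by rw [hΨ0]; exact Metric.mem_ball_self hρ)))))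
  have hΦle {w : ℂ} (hw : w ∈ Metric.ball 0 ρ) : ‖Φ w‖ ≤ 2 * ‖w‖ := by
    obtain ⟨-, -, hlo, -⟩ := hball w hw
    rw [hΦ, norm_mul, norm_inv, mul_comm]
    gcongr
    rw [show (2 : ℝ) = (1 / 2)⁻¹ by norm_num]
    exact inv_anti₀ (by norm_num) hlo.le
  have hleΦ {w : ℂ} (hw : w ∈ Metric.ball 0 ρ) : ‖w‖ ≤ 2 * ‖Φ w‖ := by
    obtain ⟨-, -, hlo, hhi, -⟩ := hball w hw
    have hQne : ‖Q w‖ ≠ 0 := (lt_trans (by norm_num) hlo).ne'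
    rw [hΦ, norm_mul, norm_inv]
    calc ‖w‖ = ‖Q w‖ * (‖w‖ * ‖Q w‖⁻¹) := by field_simp
      _ ≤ 2 * (‖w‖ * ‖Q w‖⁻¹) := by gcongr
  set δ := Real.sqrt d with hδ
  have hδ0 : 0 < δ := Real.sqrt_pos.mpr hd
  set lam : ℝ → ℂ := fun s ↦ (Ψ ((s : ℂ) ^ 2))⁻¹ with hlam
  have hmem {s : ℝ} (hs : s ∈ Ioo 0 δ) : ((s : ℂ) ^ 2) ∈ Metric.ball (0 : ℂ) d := by
    rw [mem_ball_zero_iff, norm_pow, Complex.norm_real, Real.norm_of_nonneg hs.1.le]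
    exact (Real.lt_sqrt hs.1.le).mp hs.2
  have hΦΨ {s : ℝ} (hs : s ∈ Ioo 0 δ) : Φ (Ψ ((s : ℂ) ^ 2)) = (s : ℂ) ^ 2 :=
    (hball' _ (hmem hs)).1
  have hw_mem {s : ℝ} (hs : s ∈ Ioo 0 δ) : Ψ ((s : ℂ) ^ 2) ∈ Metric.ball 0 ρ :=
    (hball' _ (hmem hs)).2.2
  have hs_ne {s : ℝ} (hs : s ∈ Ioo 0 δ) : (s : ℂ) ≠ 0 := Complex.ofReal_ne_zero.mpr hs.1.ne'
  have hw_ne {s : ℝ} (hs : s ∈ Ioo 0 δ) : Ψ ((s : ℂ) ^ 2) ≠ 0 := fun h ↦ by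
    have := hΦΨ hs
    rw [h, hΦ0] at this
    exact pow_ne_zero 2 (hs_ne hs) this.symm
  have hQ_ne {w : ℂ} (hw : w ∈ Metric.ball 0 ρ) : Q w ≠ 0 :=
    norm_pos_iff.mp (lt_trans (by norm_num) (hball w hw).2.2.1)
  have hkey {s : ℝ} (hs : s ∈ Ioo 0 δ) :
      (Ψ ((s : ℂ) ^ 2))⁻¹ * Q (Ψ ((s : ℂ) ^ 2)) = 1 / (s : ℂ) ^ 2 := by
    rw [← hΦΨ hs]
    simp only [hΦ]
    have := hw_ne hs
    have := hQ_ne (hw_mem hs)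
    rw [show Ψ (Ψ ((s : ℂ) ^ 2) * (Q (Ψ ((s : ℂ) ^ 2)))⁻¹) = Ψ ((s : ℂ) ^ 2) from by
      rw [show Ψ ((s : ℂ) ^ 2) * (Q (Ψ ((s : ℂ) ^ 2)))⁻¹ = (s : ℂ) ^ 2 from hΦΨ hs]]
    field_simp
  have hnorm_sq {s : ℝ} (hs : s ∈ Ioo 0 δ) : ‖Φ (Ψ ((s : ℂ) ^ 2))‖ = s ^ 2 := by
    rw [hΦΨ hs, norm_pow, Complex.norm_real, Real.norm_of_nonneg hs.1.le]
  -- With `w = Ψ(s²)` the difference equals `-(Q(w) - 1 - cw)/w`, which is at most `K|w|`, and `|w|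
  -- ≤ 2s²`.
  have hest {s : ℝ} (hs : s ∈ Ioo 0 δ) :
      ‖lam s - (1 / (s : ℂ) ^ 2 - c)‖ ≤ 2 * K * s ^ 2 := by
    rw [← hkey hs]
    have hw := hw_mem hs
    have hwle := hleΦ hw
    rw [hnorm_sq hs] at hwle
    have hne := hw_ne hs
    have hb := (hball _ hw).2.1
    simp only [hlam]
    set w := Ψ ((s : ℂ) ^ 2)
    rw [hQ0, hQ1, norm_pow] at hb
    have e : w⁻¹ - (w⁻¹ * Q w - c) = -(w⁻¹ * (Q w - (1 + c * w))) := by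
      field_simp
      ring
    have hwpos : 0 < ‖w‖ := norm_pos_iff.mpr hne
    rw [e, norm_neg, norm_mul, norm_inv]
    calc ‖w‖⁻¹ * ‖Q w - (1 + c * w)‖ ≤ ‖w‖⁻¹ * (K * ‖w‖ ^ 2) := by gcongr
      _ = K * ‖w‖ := by field_simp
      _ ≤ K * (2 * s ^ 2) := by gcongr
      _ = 2 * K * s ^ 2 := by ring
  have hlam_an : AnalyticOnNhd ℝ lam (Ioo 0 δ) := by
    intro s hs
    have h1 : AnalyticAt ℝ Ψ ((s : ℂ) ^ 2) := (hball' _ (hmem hs)).2.1.restrictScalars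
    have h2 : AnalyticAt ℝ (fun s : ℝ ↦ (s : ℂ) ^ 2) s := (Complex.ofRealCLM.analyticAt s).pow 2
    exact (AnalyticAt.comp (f := fun s : ℝ ↦ (s : ℂ) ^ 2) h1 h2).inv (hw_ne hs)
  refine ⟨δ, lam, hδ0, hlam_an, ?_, ?_, ?_, ?_, ⟨?_, ?_⟩, ?_⟩
  · intro s hs s' hs' h
    have h1 : (s : ℂ) ^ 2 = (s' : ℂ) ^ 2 := by
      rw [← hΦΨ hs, ← hΦΨ hs', inv_injective h]
    have h2 : s ^ 2 = s' ^ 2 := by exact_mod_cast h1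
    exact (pow_left_inj₀ hs.1.le hs'.1.le two_ne_zero).mp h2
  · intro s hs h0
    -- A zero of the derivative would, through `Φ(1/lam s) = s²`, force `2s = 0`.
    have hld : HasDerivAt lam 0 s := h0 ▸ (hlam_an s hs).differentiableAt.hasDerivAt
    have hne : lam s ≠ 0 := inv_ne_zero (hw_ne hs)
    have hinv := hld.inv hne
    have hΦd : HasDerivAt Φ (deriv Φ (lam s)⁻¹) (lam s)⁻¹ := by
      refine AnalyticAt.differentiableAt ?_ |>.hasDerivAt
      simp only [hlam, inv_inv]
      exact (hball _ (hw_mem hs)).2.2.2.2.2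
    have h1 := HasDerivAt.comp (h₂ := Φ) s hΦd hinv
    have h2 : HasDerivAt (fun s : ℝ ↦ (s : ℂ) ^ 2) (2 * (s : ℂ)) s := by
      exact ((Complex.ofRealCLM.hasDerivAt (x := s)).pow 2).congr_deriv (by simp)
    have h3 := h2.unique (h1.congr_of_eventuallyEq (by
      filter_upwards [isOpen_Ioo.mem_nhds hs] with r hr
      simp only [Function.comp_apply, Pi.inv_apply, hlam, inv_inv]
      exact (hΦΨ hr).symm))
    rw [neg_zero, zero_div, mul_zero] at h3
    exact mul_ne_zero two_ne_zero (hs_ne hs) h3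
  · rintro _ ⟨s, hs, rfl⟩
    have hwpos : 0 < ‖Ψ ((s : ℂ) ^ 2)‖ := norm_pos_iff.mpr (hw_ne hs)
    refine (hS _ ?_).mpr ⟨1 / s ^ 2, by positivity, ?_⟩
    · rw [hlam, norm_inv, ← one_div, lt_div_iff₀ hwpos]
      exact (hball _ (hw_mem hs)).2.2.2.2.1
    · simp only [hlam, inv_inv]
      rw [hkey hs]
      push_cast
      rfl
  -- Beyond this radius the membership criterion holds, `1/z` lies in the ball where `Ψ` inverts
  -- `Φ`, and `|Φ(1/z)| ≤ 2/|z| < d` makes the parameter smaller than `δ`.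
  · refine (Metric.isBounded_closedBall (x := (0 : ℂ)) (r := max R (max ρ⁻¹ (2 / d)))).subset ?_
    rintro z ⟨hz, hzΓ⟩
    rw [mem_closedBall_zero_iff]
    by_contra! hlt
    refine hzΓ ?_
    obtain ⟨hzR, hz2⟩ := max_lt_iff.mp hlt
    obtain ⟨hzρ, hzd⟩ := max_lt_iff.mp hz2
    have hzpos : 0 < ‖z‖ := (inv_pos.mpr hρ).trans hzρ
    have hz0 : z ≠ 0 := norm_pos_iff.mp hzpos
    have hwρ : z⁻¹ ∈ Metric.ball (0 : ℂ) ρ := by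
      rw [mem_ball_zero_iff, norm_inv]
      exact inv_lt_of_inv_lt₀ hρ hzρ
    obtain ⟨t, ht, hzt⟩ := (hS z hzR).mp hz
    have hΦt : Φ z⁻¹ = ((1 / t : ℝ) : ℂ) := by
      push_cast
      rw [← hzt, hΦ, one_div, mul_inv]
    have htne : t ≠ 0 := by
      rintro rfl
      rw [Complex.ofReal_zero] at hzt
      exact mul_ne_zero hz0 (hQ_ne hwρ) hzt
    have htpos : 0 < t := lt_of_le_of_ne ht htne.symm
    have hs2 : ((Real.sqrt (1 / t) : ℝ) : ℂ) ^ 2 = Φ z⁻¹ := by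
      rw [hΦt, ← Complex.ofReal_pow, Real.sq_sqrt (by positivity)]
    refine ⟨Real.sqrt (1 / t), ⟨Real.sqrt_pos.mpr (by positivity), ?_⟩, ?_⟩
    · refine Real.sqrt_lt_sqrt (by positivity) ?_
      have h1 : ‖Φ z⁻¹‖ = 1 / t := by
        rw [hΦt, Complex.norm_real, Real.norm_of_nonneg (by positivity)]
      rw [← h1]
      refine (hΦle hwρ).trans_lt ?_
      rw [norm_inv, ← div_eq_mul_inv, div_lt_iff₀ hzpos]
      rw [div_lt_iff₀ hd] at hzd
      linarith
    · simp only [hlam, hs2, (hball _ hwρ).1, inv_inv]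
  · have hlim : Tendsto (fun z : ℂ ↦ 4 * K * ‖z‖⁻¹) (cobounded ℂ ⊓ 𝓟 (lam '' Ioo 0 δ)) (𝓝 0) := by
      have := (tendsto_inv_atTop_zero.comp (tendsto_norm_cobounded_atTop (E := ℂ))).const_mul
        (4 * K)
      rw [mul_zero] at this
      exact this.mono_left inf_le_left
    refine squeeze_zero' (.of_forall fun z ↦ Metric.infDist_nonneg) ?_ hlim
    filter_upwards [mem_inf_of_right (mem_principal_self _)]
    rintro _ ⟨s, hs, rfl⟩
    have hmemH : 1 / (s : ℂ) ^ 2 - c ∈ shiftedHalfLine (-c) :=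
      ⟨1 / s ^ 2, by positivity, by push_cast; ring⟩
    refine (Metric.infDist_le_dist_of_mem hmemH).trans ?_
    rw [dist_eq_norm]
    refine (hest hs).trans ?_
    have h1 : s ^ 2 ≤ 2 * ‖lam s‖⁻¹ := by
      rw [← hnorm_sq hs, hlam, norm_inv, inv_inv]
      exact hΦle (hw_mem hs)
    calc 2 * K * s ^ 2 ≤ 2 * K * (2 * ‖lam s‖⁻¹) := by gcongr
      _ = _ := by ring
  · have hlim : Tendsto (fun z : ℂ ↦ 2 * K * (‖z‖ - ‖c‖)⁻¹)
        (cobounded ℂ ⊓ 𝓟 (shiftedHalfLine (-c))) (𝓝 0) := by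
      have h1 : Tendsto (fun z : ℂ ↦ ‖z‖ - ‖c‖) (cobounded ℂ) atTop :=
        tendsto_atTop_add_const_right _ _ tendsto_norm_cobounded_atTop
      have := (tendsto_inv_atTop_zero.comp h1).const_mul (2 * K)
      rw [mul_zero] at this
      exact this.mono_left inf_le_left
    refine squeeze_zero' (.of_forall fun z ↦ Metric.infDist_nonneg) ?_ hlim
    filter_upwards [mem_inf_of_right (mem_principal_self _),
      mem_inf_of_left ((tendsto_norm_cobounded_atTop (E := ℂ)).eventually_gt_atTop
        (‖c‖ + 1 / d))]
    rintro _ ⟨t, ht, rfl⟩ hlarge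
    have hle : ‖(t : ℂ) + -c‖ ≤ t + ‖c‖ := by
      refine (norm_add_le _ _).trans ?_
      rw [norm_neg, Complex.norm_real, Real.norm_of_nonneg ht]
    have hgt : 1 / d < ‖(t : ℂ) + -c‖ - ‖c‖ := by linarith [hlarge]
    have hdpos : 0 < 1 / d := by positivity
    have htd : 1 / d < t := by linarith
    have htpos : 0 < t := hdpos.trans htd
    -- The point `t - c` of the half-line is compared with the arc at `s = 1/√t`, where `1/s² - c`
    -- is exactly that point.
    have hs : Real.sqrt (1 / t) ∈ Ioo 0 δ :=
      ⟨Real.sqrt_pos.mpr (by positivity), Real.sqrt_lt_sqrt (by positivity)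
        ((one_div_lt hd htpos).mp htd)⟩
    refine (Metric.infDist_le_dist_of_mem (mem_image_of_mem lam hs)).trans ?_
    have h2 := hest hs
    have h3 : Real.sqrt (1 / t) ^ 2 = 1 / t := Real.sq_sqrt (by positivity)
    rw [← Complex.ofReal_pow, h3] at h2
    push_cast at h2
    rw [one_div_one_div, sub_eq_add_neg (t : ℂ)] at h2
    rw [dist_comm, dist_eq_norm]
    refine h2.trans ?_
    rw [one_div]
    gcongr
    · linarith
    · linarith
  · refine IsBigO.of_bound (2 * K) ?_
    filter_upwards [Ioo_mem_nhdsGT hδ0] with s hs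
    rw [norm_pow, Real.norm_of_nonneg hs.1.le]
    exact hest hs

end Asymptotics

/-! ### Analytic dependence on `w` of the integral of `(1 + w b)⁻¹`. -/

section Resolvent

variable {b : ℝ → ℂ} {B r : ℝ}

lemma one_half_le_norm_one_add_mul (hB : ∀ x, ‖b x‖ ≤ B) (hBr : B * r ≤ 1 / 2) {w : ℂ}
    (hw : ‖w‖ < r) (x : ℝ) : 1 / 2 ≤ ‖1 + w * b x‖ := by
  have hB0 : 0 ≤ B := (norm_nonneg _).trans (hB 0)
  have h1 : ‖w * b x‖ ≤ 1 / 2 := by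
    rw [norm_mul, mul_comm]
    exact (mul_le_mul (hB x) hw.le (norm_nonneg _) hB0).trans hBr
  have h2 := norm_sub_le (1 + w * b x) (w * b x)
  rw [add_sub_cancel_right, norm_one] at h2
  linarith

lemma hasDerivAt_integral_inv_one_add_mul (hb : Continuous b) (hB : ∀ x, ‖b x‖ ≤ B)
    (hBr : B * r ≤ 1 / 2) {T : ℝ} {w : ℂ} (hw : ‖w‖ < r) :
    HasDerivAt (fun w : ℂ ↦ ∫ x in (0 : ℝ)..T, (1 + w * b x)⁻¹)
      (∫ x in (0 : ℝ)..T, -b x / (1 + w * b x) ^ 2) w := by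
  have hlow {w : ℂ} (hw : ‖w‖ < r) (x : ℝ) := one_half_le_norm_one_add_mul hB hBr hw x
  have hne {w : ℂ} (hw : ‖w‖ < r) (x : ℝ) : 1 + w * b x ≠ 0 :=
    norm_pos_iff.mp (lt_of_lt_of_le (by norm_num) (hlow hw x))
  have hcont {w : ℂ} (hw : ‖w‖ < r) : Continuous fun x ↦ (1 + w * b x)⁻¹ :=
    (by fun_prop : Continuous fun x ↦ 1 + w * b x).inv₀ (hne hw)
  have hball : Metric.ball (0 : ℂ) r ∈ 𝓝 w :=
    Metric.isOpen_ball.mem_nhds (by simpa using hw)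
  refine (intervalIntegral.hasDerivAt_integral_of_dominated_loc_of_deriv_le
    (F' := fun w x ↦ -b x / (1 + w * b x) ^ 2) (bound := fun _ ↦ 4 * B) hball ?_
    ((hcont hw).intervalIntegrable _ _) ?_ ?_ intervalIntegrable_const ?_).2
  · filter_upwards [hball] with v hv
    exact (hcont (by simpa using hv)).aestronglyMeasurable
  · exact (hb.neg.div (by fun_prop) fun x ↦ pow_ne_zero 2 (hne hw x)).aestronglyMeasurable
  · refine .of_forall fun x _ v hv ↦ ?_
    have hv' : ‖v‖ < r := by simpa using hv
    have h2 : (1 / 2 : ℝ) ^ 2 ≤ ‖1 + v * b x‖ ^ 2 := by gcongr; exact hlow hv' x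
    rw [norm_div, norm_neg, norm_pow, div_le_iff₀ (lt_of_lt_of_le (by norm_num) h2)]
    have hB0 : 0 ≤ B := (norm_nonneg _).trans (hB 0)
    calc ‖b x‖ ≤ 4 * B * (1 / 2) ^ 2 := by linarith [hB x]
      _ ≤ _ := by gcongr
  · refine .of_forall fun x _ v hv ↦ ?_
    have h := (((hasDerivAt_id v).mul_const (b x)).const_add 1).inv
      (hne (by simpa using hv) x)
    exact h.congr_deriv (by simp)

lemma analyticAt_integral_inv_one_add_mul (hb : Continuous b) (hB : ∀ x, ‖b x‖ ≤ B) (T : ℝ) :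
    AnalyticAt ℂ (fun w : ℂ ↦ ∫ x in (0 : ℝ)..T, (1 + w * b x)⁻¹) 0 ∧
      HasDerivAt (fun w : ℂ ↦ ∫ x in (0 : ℝ)..T, (1 + w * b x)⁻¹)
        (-∫ x in (0 : ℝ)..T, b x) 0 := by
  have hB0 : 0 ≤ B := (norm_nonneg _).trans (hB 0)
  set r : ℝ := 1 / (2 * (B + 1)) with hr
  have hr0 : 0 < r := by positivity
  have hBr : B * r ≤ 1 / 2 := by
    rw [hr, mul_one_div, div_le_div_iff₀ (by positivity) (by positivity)]
    linarith
  constructor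
  · refine DifferentiableOn.analyticAt (s := Metric.ball 0 r) (fun w hw ↦ ?_)
      (Metric.ball_mem_nhds _ hr0)
    exact (hasDerivAt_integral_inv_one_add_mul hb hB hBr
      (by simpa using hw)).differentiableAt.differentiableWithinAt
  · refine (hasDerivAt_integral_inv_one_add_mul hb hB hBr (by simpa using hr0)).congr_deriv ?_
    simp

end Resolvent

/-- Turns the condition on the multiplier into one on `M²`, which, unlike `M`, does not depend on
the choice of the root `P`. -/
lemma re_eq_zero_iff_exists_neg_sq_div_four (M : ℂ) :
    M.re = 0 ↔ ∃ t : ℝ, 0 ≤ t ∧ -M ^ 2 / 4 = t := by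
  constructor
  · intro h
    refine ⟨M.im ^ 2 / 4, by positivity, ?_⟩
    have : M = M.im * Complex.I := by
      apply Complex.ext <;> simp [h]
    rw [this]
    push_cast
    rw [mul_pow, Complex.I_sq]
    simp
  · rintro ⟨t, ht, h⟩
    have h1 : M ^ 2 = ((-4 * t : ℝ) : ℂ) := by
      push_cast
      linear_combination -4 * h
    have hre := congrArg Complex.re h1
    have him := congrArg Complex.im h1
    rw [sq, Complex.mul_re, Complex.ofReal_re] at hre
    rw [sq, Complex.mul_im, Complex.ofReal_im] at him
    by_contra hne
    have : M.im = 0 := by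
      rcases mul_eq_zero.mp (by linarith : M.re * M.im = 0) with h | h
      · exact absurd h hne
      · exact h
    rw [this] at hre
    have := mul_self_pos.mpr hne
    linarith

/-! ### Floquet solutions and quasi-momentum of the Lamé equation. -/

namespace PeriodPair

variable (L : PeriodPair) {ω z₀ : ℂ}

lemma continuous_weierstrassP_line (hz₀ : ∀ x : ℝ, ω * (x : ℂ) + z₀ ∉ L.lattice) :
    Continuous fun x : ℝ ↦ L.weierstrassP (ω * x + z₀) :=
  continuous_iff_continuousAt.mpr fun x ↦
    (L.hasDerivAt_weierstrassP (hz₀ x)).comp_ofReal_line.continuousAt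

lemma periodic_weierstrassP_line (h2ω : 2 * ω ∈ L.lattice) :
    Function.Periodic (fun x : ℝ ↦ L.weierstrassP (ω * x + z₀)) 2 := fun x ↦ by
  have := L.weierstrassP_add_coe (ω * x + z₀) ⟨2 * ω, h2ω⟩
  simp only at this ⊢
  rw [← this]
  push_cast
  ring_nf

lemma periodic_derivWeierstrassP_line (h2ω : 2 * ω ∈ L.lattice) :
    Function.Periodic (fun x : ℝ ↦ L.derivWeierstrassP (ω * x + z₀)) 2 := fun x ↦ by
  have := L.derivWeierstrassP_add_coe (ω * x + z₀) ⟨2 * ω, h2ω⟩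
  simp only at this ⊢
  rw [← this]
  push_cast
  ring_nf

/-- The logarithmic derivative of a solution of `y'' = (2 ω² ℘ + ω² E) y` along the line
`ω x + z₀`, where `P² = 4 E³ - g₂ E - g₃`. -/
noncomputable def lameLogDeriv (ω z₀ E P : ℂ) (x : ℝ) : ℂ :=
  ω * (L.derivWeierstrassP (ω * x + z₀) - P) / (2 * (L.weierstrassP (ω * x + z₀) - E))

lemma periodic_lameLogDeriv (h2ω : 2 * ω ∈ L.lattice) (E P : ℂ) :
    Function.Periodic (L.lameLogDeriv ω z₀ E P) 2 := fun x ↦ by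
  have h1 := L.periodic_weierstrassP_line (z₀ := z₀) h2ω x
  have h2 := L.periodic_derivWeierstrassP_line (z₀ := z₀) h2ω x
  simp only [lameLogDeriv] at h1 h2 ⊢
  rw [h1, h2]

/-- After clearing denominators and inserting `℘'' = 6℘² - g₂/2`, the identity is the difference of
the cubic equations for `(E, P)` and `(℘, ℘')`. -/
lemma hasDerivAt_lameLogDeriv (hz₀ : ∀ x : ℝ, ω * (x : ℂ) + z₀ ∉ L.lattice) {E P : ℂ}
    (hP : P ^ 2 = 4 * E ^ 3 - L.g₂ * E - L.g₃) {x : ℝ}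
    (hE : L.weierstrassP (ω * x + z₀) ≠ E) :
    HasDerivAt (L.lameLogDeriv ω z₀ E P)
      (ω ^ 2 * (2 * L.weierstrassP (ω * x + z₀) + E) - L.lameLogDeriv ω z₀ E P x ^ 2) x := by
  have h1 := ((L.hasDerivAt_derivWeierstrassP (hz₀ x)).comp_ofReal_line.sub_const P).const_mul ω
  have h2 := ((L.hasDerivAt_weierstrassP (hz₀ x)).comp_ofReal_line.sub_const E).const_mul 2
  have hne : L.weierstrassP (ω * x + z₀) - E ≠ 0 := sub_ne_zero.mpr hE
  refine (h1.div h2 (mul_ne_zero two_ne_zero hne)).congr_deriv ?_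
  have hsq := L.derivWeierstrassP_sq _ (hz₀ x)
  simp only [lameLogDeriv]
  set p := L.weierstrassP (ω * x + z₀)
  set p' := L.derivWeierstrassP (ω * x + z₀)
  field_simp
  linear_combination ω ^ 2 * (hP - hsq)

/-- The part with `℘'/(℘ - E)` is half the derivative of `log(1 - ℘/E)`. As `|℘| < |E|`, the
principal branch is smooth and periodic along the line, so this part integrates to zero. -/
lemma integral_lameLogDeriv (h2ω : 2 * ω ∈ L.lattice)
    (hz₀ : ∀ x : ℝ, ω * (x : ℂ) + z₀ ∉ L.lattice) {E P : ℂ}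
    (hE : ∀ x : ℝ, ‖L.weierstrassP (ω * x + z₀)‖ < ‖E‖) :
    ∫ x in (0 : ℝ)..2, L.lameLogDeriv ω z₀ E P x =
      -(P / 2) * (ω * ∫ x in (0 : ℝ)..2, (L.weierstrassP (ω * x + z₀) - E)⁻¹) := by
  have hpc := L.continuous_weierstrassP_line hz₀
  have hp'c : Continuous fun x : ℝ ↦ L.derivWeierstrassP (ω * x + z₀) :=
    continuous_iff_continuousAt.mpr fun x ↦
      (L.hasDerivAt_derivWeierstrassP (hz₀ x)).comp_ofReal_line.continuousAt
  have hne (x : ℝ) : L.weierstrassP (ω * x + z₀) - E ≠ 0 := fun h ↦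
    (hE x).ne (by rw [sub_eq_zero.mp h])
  have hE0 : E ≠ 0 := norm_pos_iff.mp ((norm_nonneg _).trans_lt (hE 0))
  have hinv : Continuous fun x : ℝ ↦ (L.weierstrassP (ω * x + z₀) - E)⁻¹ :=
    (hpc.sub continuous_const).inv₀ hne
  have hlog (x : ℝ) : HasDerivAt
      (fun x : ℝ ↦ Complex.log (1 - L.weierstrassP (ω * x + z₀) / E))
      (ω * L.derivWeierstrassP (ω * x + z₀) * (L.weierstrassP (ω * x + z₀) - E)⁻¹) x := by
    have hd := ((L.hasDerivAt_weierstrassP (hz₀ x)).comp_ofReal_line.div_const E).const_sub 1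
    have hslit : 1 - L.weierstrassP (ω * x + z₀) / E ∈ Complex.slitPlane := by
      rw [sub_eq_add_neg]
      refine Complex.mem_slitPlane_of_norm_lt_one ?_
      rw [norm_neg, norm_div, div_lt_one (norm_pos_iff.mpr hE0)]
      exact hE x
    refine (hd.clog_real hslit).congr_deriv ?_
    have h1 := hne x
    have h2 : E - L.weierstrassP (ω * x + z₀) ≠ 0 := by rw [← neg_sub]; exact neg_ne_zero.mpr h1
    rw [one_sub_div hE0]
    field_simp
    ring
  have hzero : ∫ x in (0 : ℝ)..2,
      ω * L.derivWeierstrassP (ω * x + z₀) * (L.weierstrassP (ω * x + z₀) - E)⁻¹ = 0 := by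
    rw [intervalIntegral.integral_eq_sub_of_hasDerivAt (fun x _ ↦ hlog x)
      (((continuous_const.mul hp'c).mul hinv).intervalIntegrable _ _)]
    have := L.periodic_weierstrassP_line (z₀ := z₀) h2ω 0
    simp only [zero_add] at this
    rw [this, sub_self]
  have hsplit : (fun x ↦ L.lameLogDeriv ω z₀ E P x) = fun x : ℝ ↦
      1 / 2 * (ω * L.derivWeierstrassP (ω * x + z₀) * (L.weierstrassP (ω * x + z₀) - E)⁻¹) +
        -(P / 2) * (ω * (L.weierstrassP (ω * x + z₀) - E)⁻¹) := by
    funext x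
    have := hne x
    rw [lameLogDeriv]
    field_simp
    ring
  rw [hsplit, intervalIntegral.integral_add
    (Continuous.intervalIntegrable (by fun_prop) _ _)
    (Continuous.intervalIntegrable (by fun_prop) _ _),
    intervalIntegral.integral_const_mul, intervalIntegral.integral_const_mul,
    intervalIntegral.integral_const_mul, hzero, mul_zero, zero_add]

/-- Up to the factor `w`, the square of the quasi-momentum of the Lamé equation over a half-period
at the spectral parameter `w⁻¹`. -/
noncomputable def lameQuasimomentumSq (ω z₀ w : ℂ) : ℂ :=
  (1 - L.g₂ / 4 * ω ^ 4 * w ^ 2 + L.g₃ / 4 * ω ^ 6 * w ^ 3) *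
    (∫ x in (0 : ℝ)..2, (1 + w * (ω ^ 2 * L.weierstrassP (ω * x + z₀)))⁻¹) ^ 2 / 4

lemma neg_sq_integral_lameLogDeriv (hω : ω ≠ 0) (h2ω : 2 * ω ∈ L.lattice)
    (hz₀ : ∀ x : ℝ, ω * (x : ℂ) + z₀ ∉ L.lattice) {lam E P : ℂ} (hlam : lam ≠ 0)
    (hElam : E = -lam / ω ^ 2) (hP : P ^ 2 = 4 * E ^ 3 - L.g₂ * E - L.g₃)
    (hE : ∀ x : ℝ, ‖L.weierstrassP (ω * x + z₀)‖ < ‖E‖) :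
    -(∫ x in (0 : ℝ)..2, L.lameLogDeriv ω z₀ E P x) ^ 2 / 4 =
      lam * L.lameQuasimomentumSq ω z₀ lam⁻¹ := by
  have hinv (x : ℝ) : (L.weierstrassP (ω * x + z₀) - E)⁻¹ =
      ω ^ 2 * lam⁻¹ * (1 + lam⁻¹ * (ω ^ 2 * L.weierstrassP (ω * x + z₀)))⁻¹ := by
    have hne : L.weierstrassP (ω * x + z₀) - E ≠ 0 := fun h ↦
      (hE x).ne (by rw [sub_eq_zero.mp h])
    have e : L.weierstrassP (ω * x + z₀) - E =
        lam / ω ^ 2 * (1 + lam⁻¹ * (ω ^ 2 * L.weierstrassP (ω * x + z₀))) := by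
      rw [hElam]
      field_simp
      ring
    rw [e, mul_inv, inv_div]
    ring
  rw [L.integral_lameLogDeriv h2ω hz₀ hE, lameQuasimomentumSq]
  simp only [hinv]
  rw [intervalIntegral.integral_const_mul]
  set K := ∫ x in (0 : ℝ)..2, (1 + lam⁻¹ * (ω ^ 2 * L.weierstrassP (ω * x + z₀)))⁻¹
  have e1 : (-(P / 2) * (ω * (ω ^ 2 * lam⁻¹ * K))) ^ 2 =
      P ^ 2 * (ω ^ 6 * lam⁻¹ ^ 2 * K ^ 2) / 4 := by ring
  rw [e1, hP, hElam]
  field_simp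
  ring

/-- The invariants `g₂` and `g₃` enter only from order `w²`, so the first order term comes from the
integral of `℘` over a period alone. -/
lemma lameQuasimomentumSq_asymptotics (hω : ω ∉ L.lattice) (h2ω : 2 * ω ∈ L.lattice)
    (hz₀ : ∀ x : ℝ, ω * (x : ℂ) + z₀ ∉ L.lattice) :
    AnalyticAt ℂ (L.lameQuasimomentumSq ω z₀) 0 ∧ L.lameQuasimomentumSq ω z₀ 0 = 1 ∧
      deriv (L.lameQuasimomentumSq ω z₀) 0 = 2 * weierstrassZeta L ω * ω := by
  have hpc := L.continuous_weierstrassP_line hz₀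
  obtain ⟨B, hB⟩ := (L.periodic_weierstrassP_line (z₀ := z₀) h2ω).exists_norm_le two_ne_zero hpc
  obtain ⟨hKa, hKd⟩ := analyticAt_integral_inv_one_add_mul
    (b := fun x : ℝ ↦ ω ^ 2 * L.weierstrassP (ω * x + z₀)) (B := ‖ω ^ 2‖ * B) (by fun_prop)
    (fun x ↦ by rw [norm_mul]; gcongr; exact hB x) 2
  have hSa : AnalyticAt ℂ
      (fun w : ℂ ↦ 1 - L.g₂ / 4 * ω ^ 4 * w ^ 2 + L.g₃ / 4 * ω ^ 6 * w ^ 3) 0 := by fun_prop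
  have hSd : HasDerivAt
      (fun w : ℂ ↦ 1 - L.g₂ / 4 * ω ^ 4 * w ^ 2 + L.g₃ / 4 * ω ^ 6 * w ^ 3) 0 0 := by
    refine (((((hasDerivAt_id (0 : ℂ)).pow 2).const_mul (L.g₂ / 4 * ω ^ 4)).const_sub 1).add
      (((hasDerivAt_id (0 : ℂ)).pow 3).const_mul (L.g₃ / 4 * ω ^ 6))).congr_deriv ?_
    simp
  have hK0 : ∫ x in (0 : ℝ)..2,
      (1 + (0 : ℂ) * (ω ^ 2 * L.weierstrassP (ω * x + z₀)))⁻¹ = 2 := by simp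
  refine ⟨(hSa.mul (hKa.pow 2)).div_const, ?_, ?_⟩
  · rw [lameQuasimomentumSq, hK0]
    norm_num
  · have hQ : HasDerivAt (L.lameQuasimomentumSq ω z₀) _ 0 := (hSd.mul (hKd.pow 2)).div_const 4
    rw [hQ.deriv]
    have hint := L.integral_weierstrassP_segment hω h2ω hz₀
    simp only [Pi.pow_apply, hK0, intervalIntegral.integral_const_mul]
    push_cast
    linear_combination -ω * hint

lemma exists_mem_lameSpectrum_iff (hω : ω ∉ L.lattice) (h2ω : 2 * ω ∈ L.lattice)
    (hz₀ : ∀ x : ℝ, ω * (x : ℂ) + z₀ ∉ L.lattice) :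
    ∃ R : ℝ, ∀ z : ℂ, R < ‖z‖ → (z ∈ lameSpectrum L 1 ω z₀ ↔
      ∃ t : ℝ, 0 ≤ t ∧ z * L.lameQuasimomentumSq ω z₀ z⁻¹ = t) := by
  have hω0 : ω ≠ 0 := fun h ↦ hω (h ▸ zero_mem _)
  have hpc := L.continuous_weierstrassP_line hz₀
  have hpp := L.periodic_weierstrassP_line (z₀ := z₀) h2ω
  obtain ⟨B, hB⟩ := hpp.exists_norm_le two_ne_zero hpc
  have hB0 : 0 ≤ B := (norm_nonneg _).trans (hB 0)
  -- This threshold is exactly `|E| > B`, so `℘ - E` has no zero on the line.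
  refine ⟨B * ‖ω‖ ^ 2, fun z hz ↦ ?_⟩
  have hz0 : z ≠ 0 := norm_pos_iff.mp (lt_of_le_of_lt (by positivity) hz)
  set E := -z / ω ^ 2 with hE
  have hEn : B < ‖E‖ := by
    rw [hE, norm_div, norm_neg, norm_pow, lt_div_iff₀ (pow_pos (norm_pos_iff.mpr hω0) 2)]
    exact hz
  have hlt (x : ℝ) : ‖L.weierstrassP (ω * x + z₀)‖ < ‖E‖ := (hB x).trans_lt hEn
  obtain ⟨P, hP⟩ := IsAlgClosed.exists_pow_nat_eq (4 * E ^ 3 - L.g₂ * E - L.g₃) two_pos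
  have hqeq : lamePotential L 1 ω z₀ = fun x : ℝ ↦ 2 * ω ^ 2 * L.weierstrassP (ω * x + z₀) := by
    funext x
    rw [lamePotential]
    push_cast
    ring
  have hq : Continuous (lamePotential L 1 ω z₀) := by rw [hqeq]; fun_prop
  have hqp : Function.Periodic (lamePotential L 1 ω z₀) 2 := fun x ↦ by
    have := hpp x
    simp only [hqeq] at this ⊢
    rw [this]
  have hφ (x : ℝ) := L.hasDerivAt_lameLogDeriv hz₀ hP (x := x)
    (fun h ↦ (hlt x).ne (by rw [h]))
  have hφp := L.periodic_lameLogDeriv (z₀ := z₀) h2ω E P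
  have hR (x : ℝ) : ω ^ 2 * (2 * L.weierstrassP (ω * x + z₀) + E) -
      L.lameLogDeriv ω z₀ E P x ^ 2 + L.lameLogDeriv ω z₀ E P x ^ 2 =
      lamePotential L 1 ω z₀ x - z := by
    rw [hqeq, hE]
    field_simp
    ring
  rw [← L.neg_sq_integral_lameLogDeriv hω0 h2ω hz₀ hz0 hE hP hlt,
    ← re_eq_zero_iff_exists_neg_sq_div_four]
  refine ⟨fun h ↦ ?_, fun h ↦ mem_schrodingerSpectrum_of_riccati two_pos hq hqp hφ hφp hR h⟩
  by_contra hne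
  exact h (mem_schrodingerResolventSet_of_riccati two_pos hq hqp hφ hφp hR hne)

end PeriodPair

/-- Outside a bounded set, the spectrum of the complex Lamé operator with `m = 1` is a single
regular analytic arc `lam : (0, δ) → ℂ` going to infinity as `s → 0`; this arc is asymptotic to the
positive real half-line shifted by `-2ηω`, and `lam s = 1/s² - 2ηω + O(s²)`. -/
theorem proposition3p5 (L : PeriodPair) (ω z₀ η : ℂ)
    (hω : ω ∉ L.lattice) (h2ω : 2 * ω ∈ L.lattice)
    (hη : η = weierstrassZeta L ω)
    (hz₀ : ∀ x : ℝ, ω * (x : ℂ) + z₀ ∉ L.lattice) :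
    ∃ (δ : ℝ) (lam : ℝ → ℂ), 0 < δ ∧
      AnalyticOnNhd ℝ lam (Ioo 0 δ) ∧
      InjOn lam (Ioo 0 δ) ∧
      (∀ s ∈ Ioo 0 δ, deriv lam s ≠ 0) ∧
      lam '' Ioo 0 δ ⊆ lameSpectrum L 1 ω z₀ ∧
      IsBounded (lameSpectrum L 1 ω z₀ \ lam '' Ioo 0 δ) ∧
      AsymptoticAtInfinity (lam '' Ioo 0 δ) (shiftedHalfLine (-2 * η * ω)) ∧
      (fun s : ℝ => lam s - (1 / (s : ℂ) ^ 2 - 2 * η * ω)) =O[𝓝[>] 0] (fun s : ℝ => s ^ 2) := by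
  obtain ⟨hQ, hQ0, hQ1⟩ := L.lameQuasimomentumSq_asymptotics hω h2ω hz₀
  obtain ⟨R, hS⟩ := L.exists_mem_lameSpectrum_iff hω h2ω hz₀
  rw [show -2 * η * ω = -(2 * η * ω) by ring, hη]
  exact exists_analytic_arc hQ hQ0 hQ1 hS
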